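/- **Setting.** Let $\mathcal S_d=\{\rho\in\mathbb C^{d\times d}:\rho\ge 0,\ \mathrm{Tr}\,\rho=1\}$. A $d$-dimensional multi-armed quantum bandit is a nonempty set $\mathcal A$ of Hermitian $d\times d$ matrices with a $\sigma$-algebra $\Sigma$ such that, for every $\rho\in\mathcal S_d$, the reward law $P_\rho(\cdot\mid O)$ depends measurably on $O\in\mathcal A$; here, by Born's rule, $P_\rho(x\mid O)=\mathrm{Tr}(\rho\,\Pi_x)$ for each eigenvalue $x$ of $O$ with eigenprojection $\Pi_x$. It is discrete if $\mathcal A$ is finite and $\Sigma$ is the power set. A policy $\pi$ is a sequence of conditional laws (Markov kernels) $\pi_t(\cdot\mid a_1,x_1,\dots,a_{t-1},x_{t-1})$ on $\mathcal A$. Together with $\rho$ it determines the law $P_{\rho,\pi}$ of the actions $O_t\in\mathcal A$ and rewards $X_t\sim P_\rho(\cdot\mid O_t)$, $t=1,\dots,n$, and the regret is $$R_n(\mathcal A,\rho,\pi)=\sum_{t=1}^n\Big(\sup_{O\in\mathcal A}\mathrm{Tr}(\rho O)-\mathbb E_{\rho,\pi}[X_t]\Big).$$ **LinUCB.** Fix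 Hermitian matrices $\sigma_1,\dots,\sigma_{d^2}$ with $\mathrm{Tr}(\sigma_i\sigma_j)=\delta_{ij}$ and identify $O\in\mathcal A$ with $\mathbf A_O=(\mathrm{Tr}(O\sigma_i))_i\in\mathbb R^{d^2}$. Let $\lambda>0$, $n\ge 2$, and set $D=d^2$, $m=d$, $L=\sqrt d$, $\delta=1/n$. With $V_t=\lambda I+\sum_{s\le t}\mathbf A_{O_s}\mathbf A_{O_s}^T$ and $\hat\theta_t=V_t^{-1}\sum_{s\le t}X_s\mathbf A_{O_s}$, the confidence set of round $t$ is $$\mathcal C_t=\Big\{\theta\in\mathbb R^{D}:\|\theta-\hat\theta_{t-1}\|_{V_{t-1}}\le m\sqrt\lambda+\sqrt{2\log\tfrac1\delta+D\log\tfrac{D\lambda+nL^2}{D\lambda}}\Big\},\qquad \|x\|_V=\sqrt{x^TVx}.$$ A policy is a LinUCB policy (for horizon $n$) if in each round $t\le n$, after every history, it plays with probability one an action $O_t$ such that $(\mathbf A_{O_t},\tilde\theta_t)$ maximises $\langle\theta,\mathbf A_O\rangle$ over $O\in\mathcal A$, $\theta\in\mathcal C_t$, for some $\tilde\theta_t\in\mathcal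 C_t$; ties may be broken arbitrarily. **Theorem.** For every $\lambda>0$ there is a constant $C>0$, depending on nothing but $\lambda$ (so a universal constant once the regularisation is fixed, e.g. $\lambda=1$), such that the following holds for all $d$, all $n\ge 2$, every $d$-dimensional multi-armed quantum bandit whose observables satisfy $\|O\|\le 1$ in operator norm, and every choice of $\sigma_1,\dots,\sigma_{d^2}$ as above. 1. If the bandit is discrete, or if $\mathcal A$ is compact and $\Sigma$ is its Borel $\sigma$-algebra, then a LinUCB policy exists. 2. Every LinUCB policy $\pi$ satisfies, for every $\rho\in\mathcal S_d$, $$R_n(\mathcal A,\rho,\pi)\le C\,d^2\sqrt n\,\log n .$$ -/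

import Mathlib

open MeasureTheory ProbabilityTheory
open scoped Matrix ComplexOrder

noncomputable section

/-! ### States, observables and Born's rule -/

/-- Quantum states on `ℂ^d`: positive semidefinite matrices of unit trace. -/
def QState (d : ℕ) : Type :=
  {ρ : Matrix (Fin d) (Fin d) ℂ // ρ.PosSemidef ∧ ρ.trace = 1}

/-- The expectation `Tr (ρ O)` (a real number for Hermitian `O`). -/
def QState.expect {d : ℕ} (ρ : QState d) (O : Matrix (Fin d) (Fin d) ℂ) : ℝ :=
  (ρ.1 * O).trace.re

/-- The finite set of distinct eigenvalues of a Hermitian matrix. -/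
def eigenvalueSet {d : ℕ} {O : Matrix (Fin d) (Fin d) ℂ} (hO : O.IsHermitian) : Finset ℝ :=
  Finset.univ.image hO.eigenvalues

/-- The orthogonal projection onto the `x`-eigenspace of a Hermitian matrix, as the sum of the
rank-one projections onto the members of an orthonormal eigenbasis with eigenvalue `x`. -/
def spectralProj {d : ℕ} {O : Matrix (Fin d) (Fin d) ℂ} (hO : O.IsHermitian) (x : ℝ) :
    Matrix (Fin d) (Fin d) ℂ :=
  ∑ i with hO.eigenvalues i = x,
    Matrix.vecMulVec (hO.eigenvectorBasis i) (star (hO.eigenvectorBasis i : Fin d → ℂ))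

/-- Born's rule: the law of the outcome when `O` is measured on `ρ`; the outcome is the
eigenvalue `x` with probability `Tr (ρ Π_x)`. -/
def bornMeasure {d : ℕ} (ρ : QState d) {O : Matrix (Fin d) (Fin d) ℂ} (hO : O.IsHermitian) :
    Measure ℝ :=
  ∑ x ∈ eigenvalueSet hO, ENNReal.ofReal (ρ.expect (spectralProj hO x)) • Measure.dirac x

theorem expect_rankOne_nonneg {d : ℕ} (ρ : QState d) (v : Fin d → ℂ) :
    0 ≤ ρ.expect (Matrix.vecMulVec v (star v)) := by
  have h := ρ.2.1.dotProduct_mulVec_nonneg v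
  have h2 : (ρ.1 * Matrix.vecMulVec v (star v)).trace = star v ⬝ᵥ (ρ.1 *ᵥ v) := by
    rw [Matrix.mul_vecMulVec, Matrix.trace_vecMulVec, dotProduct_comm]
  unfold QState.expect
  rw [h2]
  exact (Complex.le_def.1 h).1

theorem expect_sum {d : ℕ} {ι : Type*} (ρ : QState d) (s : Finset ι)
    (f : ι → Matrix (Fin d) (Fin d) ℂ) :
    ρ.expect (∑ i ∈ s, f i) = ∑ i ∈ s, ρ.expect (f i) := by
  simp [QState.expect, Finset.mul_sum, Matrix.trace_sum]

theorem sum_rankOne_eigenvectors {d : ℕ} {O : Matrix (Fin d) (Fin d) ℂ} (hO : O.IsHermitian) :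
    ∑ i, Matrix.vecMulVec (hO.eigenvectorBasis i)
      (star (hO.eigenvectorBasis i : Fin d → ℂ)) = 1 := by
  have h : (hO.eigenvectorUnitary : Matrix (Fin d) (Fin d) ℂ) *
      star (hO.eigenvectorUnitary : Matrix (Fin d) (Fin d) ℂ) = 1 :=
    Unitary.coe_mul_star_self _
  rw [← h]
  ext i j
  simp [Matrix.mul_apply, Matrix.sum_apply, Matrix.vecMulVec_apply, Matrix.star_apply]

theorem isProbabilityMeasure_bornMeasure {d : ℕ} (ρ : QState d)
    {O : Matrix (Fin d) (Fin d) ℂ} (hO : O.IsHermitian) :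
    IsProbabilityMeasure (bornMeasure ρ hO) := by
  constructor
  have hnn : ∀ x ∈ eigenvalueSet hO, 0 ≤ ρ.expect (spectralProj hO x) := by
    intro x _
    rw [spectralProj, expect_sum]
    exact Finset.sum_nonneg fun i _ => expect_rankOne_nonneg ρ _
  have h1 : ∑ x ∈ eigenvalueSet hO, ρ.expect (spectralProj hO x) = 1 := by
    have h2 : ∑ x ∈ eigenvalueSet hO, spectralProj hO x = 1 := by
      rw [← sum_rankOne_eigenvectors hO]
      exact Finset.sum_fiberwise_of_maps_to
        (fun i _ => Finset.mem_image_of_mem _ (Finset.mem_univ i)) _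
    rw [← expect_sum, h2]
    rw [QState.expect, mul_one, ρ.2.2, Complex.one_re]
  simp only [bornMeasure, Measure.coe_finsetSum, Finset.sum_apply, Measure.smul_apply,
    measure_univ, smul_eq_mul, mul_one]
  rw [← ENNReal.ofReal_sum_of_nonneg hnn, h1, ENNReal.ofReal_one]

/-! ### Multi-armed quantum bandits -/

/-- A `d`-dimensional multi-armed quantum bandit: a nonempty set of observables (the actions),
with a σ-algebra for which the reward distribution given by Born's rule depends measurably on
the action. -/
structure QuantumBandit (d : ℕ) where
  actionSet : Set (Matrix (Fin d) (Fin d) ℂ)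
  isHermitian : ∀ O ∈ actionSet, O.IsHermitian
  nonempty : actionSet.Nonempty
  sigma : MeasurableSpace actionSet
  measurable_born : ∀ ρ : QState d,
    Measurable fun O : actionSet => bornMeasure ρ (isHermitian O.1 O.2)

namespace QuantumBandit

variable {d : ℕ}

/-- The actions (arms) of the bandit. -/
abbrev Arm (B : QuantumBandit d) : Type := B.actionSet

instance instMeasurableSpaceArm (B : QuantumBandit d) : MeasurableSpace B.Arm := B.sigma

/-- A discrete bandit: finitely many actions, all sets of actions being measurable. -/
def IsDiscrete (B : QuantumBandit d) : Prop :=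
  B.actionSet.Finite ∧ B.sigma = ⊤

/-- A bandit with a compact action set, carrying its Borel σ-algebra. -/
def IsCompactBorel (B : QuantumBandit d) : Prop :=
  IsCompact B.actionSet ∧ B.sigma = borel B.actionSet

/-- The reward distribution `P_ρ(· | a)`. -/
def reward (B : QuantumBandit d) (ρ : QState d) : Kernel B.Arm ℝ where
  toFun O := bornMeasure ρ (B.isHermitian O.1 O.2)
  measurable' := B.measurable_born ρ

instance instIsMarkovKernelReward (B : QuantumBandit d) (ρ : QState d) :
    IsMarkovKernel (B.reward ρ) :=
  ⟨fun O => isProbabilityMeasure_bornMeasure ρ (B.isHermitian O.1 O.2)⟩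

/-- Histories `(a_1, x_1, …, a_t, x_t)` of actions and rewards over `t` rounds. -/
abbrev History (B : QuantumBandit d) (t : ℕ) : Type := Fin t → B.Arm × ℝ

/-- A policy: for every `t`, a conditional probability distribution of the action of round
`t + 1` given the history of the first `t` rounds. -/
structure Policy (B : QuantumBandit d) where
  kernel : (t : ℕ) → Kernel (B.History t) B.Arm
  isMarkov : ∀ t, IsMarkovKernel (kernel t)

instance instIsMarkovKernelPolicy (B : QuantumBandit d) (π : B.Policy) (t : ℕ) :
    IsMarkovKernel (π.kernel t) :=
  π.isMarkov t

/-- The history extended by one more round. -/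
def extend (B : QuantumBandit d) (t : ℕ) (p : B.History t × (B.Arm × ℝ)) : B.History (t + 1) :=
  Fin.snoc (α := fun _ => B.Arm × ℝ) p.1 p.2

theorem measurable_extend (B : QuantumBandit d) (t : ℕ) : Measurable (B.extend t) := by
  refine measurable_pi_iff.2 fun i => ?_
  refine Fin.lastCases ?_ (fun j => ?_) i
  · simpa [extend] using measurable_snd
  · simpa [extend, Function.comp_def] using
      (measurable_pi_apply j).comp (measurable_fst (α := B.History t) (β := B.Arm × ℝ))

/-- The law `P_{ρ,π}` of the first `t` rounds: given the history, the next action is drawn from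
the policy, and given that action the reward is drawn from Born's rule. -/
def historyLaw (B : QuantumBandit d) (ρ : QState d) (π : B.Policy) :
    (t : ℕ) → Measure (B.History t)
  | 0 => Measure.dirac Fin.elim0
  | t + 1 => ((B.historyLaw ρ π t) ⊗ₘ
      ((π.kernel t) ⊗ₖ (Kernel.prodMkLeft (B.History t) (B.reward ρ)))).map (B.extend t)

instance instIsProbabilityMeasureHistoryLaw (B : QuantumBandit d) (ρ : QState d)
    (π : B.Policy) (t : ℕ) : IsProbabilityMeasure (B.historyLaw ρ π t) := by
  induction t with
  | zero => unfold historyLaw; infer_instance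
  | succ t ih =>
    unfold historyLaw
    exact Measure.isProbabilityMeasure_map (B.measurable_extend t).aemeasurable

/-- The expected cumulative regret
`R_n(A, ρ, π) = ∑_{t=1}^n (max_{O ∈ A} Tr (ρ O) - E_{ρ,π}[X_t])`. -/
def regret (B : QuantumBandit d) (ρ : QState d) (π : B.Policy) (n : ℕ) : ℝ :=
  ∑ t : Fin n, ((⨆ O : B.Arm, ρ.expect O.1) - ∫ h, (h t).2 ∂(B.historyLaw ρ π n))

end QuantumBandit

/-! ### LinUCB for linear bandits in `ℝ^D` -/

namespace LinUCB

variable {D t : ℕ}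

/-- `V_t = λ I + ∑ₛ Aₛ Aₛᵀ`. -/
def gram (lam : ℝ) (A : Fin t → Fin D → ℝ) : Matrix (Fin D) (Fin D) ℝ :=
  lam • (1 : Matrix (Fin D) (Fin D) ℝ) + ∑ s, Matrix.vecMulVec (A s) (A s)

/-- The regularised least squares estimator `V_t⁻¹ ∑ₛ Xₛ Aₛ`. -/
def estimator (lam : ℝ) (A : Fin t → Fin D → ℝ) (X : Fin t → ℝ) : Fin D → ℝ :=
  (gram lam A)⁻¹ *ᵥ ∑ s, X s • A s

/-- The confidence radius
`m √λ + √(2 log (1/δ) + D log ((D λ + n L²) / (D λ)))`. -/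
def radius (D n : ℕ) (lam m L δ : ℝ) : ℝ :=
  m * √lam + √(2 * Real.log (1 / δ) + D * Real.log ((D * lam + n * L ^ 2) / (D * lam)))

/-- The confidence ellipsoid used in round `t + 1`, built from the actions `A` and the rewards
`X` of the first `t` rounds. -/
def confidenceSet (n : ℕ) (lam m L δ : ℝ) (A : Fin t → Fin D → ℝ) (X : Fin t → ℝ) :
    Set (Fin D → ℝ) :=
  {θ | √((θ - estimator lam A X) ⬝ᵥ (gram lam A *ᵥ (θ - estimator lam A X))) ≤
    radius D n lam m L δ}

end LinUCB

/-! ### The embedding of a quantum bandit in `ℝ^(d²)` -/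

/-- `d²` Hermitian matrices `σ_i` with `Tr (σ_i σ_j) = δ_ij`. -/
structure HermitianBasis (d : ℕ) where
  mat : Fin (d ^ 2) → Matrix (Fin d) (Fin d) ℂ
  isHermitian : ∀ i, (mat i).IsHermitian
  orthonormal : ∀ i j, (mat i * mat j).trace = if i = j then 1 else 0

/-- The coordinates `Tr (O σ_i)` of a Hermitian matrix `O`. -/
def HermitianBasis.coord {d : ℕ} (σ : HermitianBasis d) (O : Matrix (Fin d) (Fin d) ℂ) :
    Fin (d ^ 2) → ℝ :=
  fun i => (O * σ.mat i).trace.re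

/-- The policy `π` runs LinUCB during the first `n` rounds, in the coordinates of `σ`, with
regularisation `λ`, bounds `‖θ‖₂ ≤ m`, `‖A‖₂ ≤ L` and confidence level `δ`: whatever the history,
it plays (with probability one) an action `a` such that
`(a, θ') = argmax_{b ∈ A, θ ∈ C} ⟨θ, b⟩` for some `θ' ∈ C`, where `C` is the current confidence
set. Ties may be broken in any way. -/
def QuantumBandit.IsLinUCB {d : ℕ} (B : QuantumBandit d) (σ : HermitianBasis d) (n : ℕ)
    (lam m L δ : ℝ) (π : B.Policy) : Prop :=
  ∀ t < n, ∀ h : B.History t, ∀ᵐ a ∂(π.kernel t h),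
    ∃ θ' ∈ LinUCB.confidenceSet n lam m L δ (fun s => σ.coord (h s).1.1) (fun s => (h s).2),
      ∀ b : B.Arm,
        ∀ θ ∈ LinUCB.confidenceSet n lam m L δ (fun s => σ.coord (h s).1.1) (fun s => (h s).2),
          θ ⬝ᵥ σ.coord b.1 ≤ θ' ⬝ᵥ σ.coord a.1

end

/-! In the coordinates of `σ`, Born's rule gives $\mathrm{Tr}(\rho O)=\langle\theta,\mathbf
A_O\rangle$ with $\theta$ the coordinate vector of $\rho$. So the bandit is a linear bandit in
dimension $D=d^2$ with $\|\theta\|\le 1$, $\|\mathbf A_O\|\le\sqrt d$ and rewards in $[-1,1]$, whose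
centred versions are 1-subgaussian by Hoeffding's lemma.

Concentration: let $S_t$ be the noise vector. The process $M_t=\sqrt{\lambda^D/\det
V_t}\,\exp(\|S_t\|^2_{V_t^{-1}}/2)$ has expectation at most one
(`lintegral_selfNormalizedExp_le_one`). Its one-round growth factor is a one-dimensional Gaussian
mixture of the Hoeffding exponentials, so no $D$-dimensional integral is needed. When $\theta$
leaves the confidence set, $M_t>1/\delta$ (`lt_selfNormalizedExp`), so by Markov this has
probability at most $\delta$ in each round.

Regret: if $\theta$ is in the confidence set, optimism bounds the regret of the round by $2\beta q$
with $q=\|\mathbf A_O\|_{V^{-1}}$ and $\beta$ a bound on the radius. Since $\log(1+q^2)$ is the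
increment of $\log\det V$, the inequality $\min(1,q)\le 1/(2c)+c\log(1+q^2)$ makes the regret minus
$2\beta c\log\det V_t$ grow in expectation by at most $2\delta+\beta/c$ per round
(`integral_compensatedRegret_le`). As $\log\det V_n$ exceeds $D\log\lambda$ by only
$O_\lambda(d^2\log n)$ and $\beta$ is of order $d\sqrt{\log n}$, the choice $c=\sqrt n/(d\sqrt{\log
n})$ gives the rate.

Existence: the maximum of $\langle\theta,\mathbf A_O\rangle$ over the ellipsoid has the closed form
`ucb`, continuous in the action and measurable in the history, and such a function has a measurable
maximiser on a compact metrizable space. -/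

noncomputable section

/-! ### Quadratic forms of positive definite real matrices -/

namespace Matrix

variable {n : Type*} [Fintype n]

/-- The seminorm `√(xᵀ M x)` of a matrix `M`. -/
def qnorm (M : Matrix n n ℝ) (x : n → ℝ) : ℝ := √(x ⬝ᵥ (M *ᵥ x))

theorem qnorm_nonneg (M : Matrix n n ℝ) (x : n → ℝ) : 0 ≤ M.qnorm x := Real.sqrt_nonneg _

theorem qnorm_neg (M : Matrix n n ℝ) (x : n → ℝ) : M.qnorm (-x) = M.qnorm x := by
  simp [qnorm, mulVec_neg]

theorem PosSemidef.quad_nonneg {M : Matrix n n ℝ} (hM : M.PosSemidef) (x : n → ℝ) :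
    0 ≤ x ⬝ᵥ (M *ᵥ x) := by
  simpa using hM.dotProduct_mulVec_nonneg x

theorem PosSemidef.qnorm_sq {M : Matrix n n ℝ} (hM : M.PosSemidef) (x : n → ℝ) :
    M.qnorm x ^ 2 = x ⬝ᵥ (M *ᵥ x) := Real.sq_sqrt (hM.quad_nonneg x)

theorem PosSemidef.dotProduct_mulVec_swap {M : Matrix n n ℝ} (hM : M.PosSemidef) (x y : n → ℝ) :
    x ⬝ᵥ (M *ᵥ y) = y ⬝ᵥ (M *ᵥ x) := by
  have h : Mᵀ = M := by simpa using hM.isHermitian.eq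
  rw [dotProduct_mulVec, ← mulVec_transpose, h, dotProduct_comm]

/-- The quadratic $r\mapsto (x+ry)^TM(x+ry)$ is nonnegative, so its discriminant is at most zero. -/
theorem PosSemidef.dotProduct_mulVec_sq_le {M : Matrix n n ℝ} (hM : M.PosSemidef)
    (x y : n → ℝ) :
    (x ⬝ᵥ (M *ᵥ y)) ^ 2 ≤ (x ⬝ᵥ (M *ᵥ x)) * (y ⬝ᵥ (M *ᵥ y)) := by
  have h : ∀ r : ℝ, 0 ≤ (y ⬝ᵥ (M *ᵥ y)) * (r * r) + (2 * (x ⬝ᵥ (M *ᵥ y))) * r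
      + x ⬝ᵥ (M *ᵥ x) := by
    intro r
    have := hM.quad_nonneg (x + r • y)
    simp only [mulVec_add, mulVec_smul, add_dotProduct, dotProduct_add, smul_dotProduct,
      dotProduct_smul, smul_eq_mul] at this
    rw [hM.dotProduct_mulVec_swap y x] at this
    linarith
  have := discrim_le_zero h
  rw [discrim] at this
  nlinarith

theorem PosSemidef.dotProduct_mulVec_le {M : Matrix n n ℝ} (hM : M.PosSemidef) (x y : n → ℝ) :
    x ⬝ᵥ (M *ᵥ y) ≤ M.qnorm x * M.qnorm y := by
  refine le_of_sq_le_sq ?_ (mul_nonneg (qnorm_nonneg _ _) (qnorm_nonneg _ _))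
  rw [mul_pow, hM.qnorm_sq, hM.qnorm_sq]
  exact hM.dotProduct_mulVec_sq_le x y

theorem PosSemidef.qnorm_sub_le {M : Matrix n n ℝ} (hM : M.PosSemidef) (x y : n → ℝ) :
    M.qnorm (x - y) ≤ M.qnorm x + M.qnorm y := by
  refine le_of_sq_le_sq ?_ (add_nonneg (qnorm_nonneg _ _) (qnorm_nonneg _ _))
  have h := hM.dotProduct_mulVec_le x (-y)
  rw [qnorm_neg] at h
  rw [add_sq, hM.qnorm_sq, hM.qnorm_sq, hM.qnorm_sq]
  simp only [mulVec_sub, sub_dotProduct, dotProduct_sub, mulVec_neg, dotProduct_neg] at h ⊢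
  rw [hM.dotProduct_mulVec_swap y x]
  linarith

theorem qnorm_smul {M : Matrix n n ℝ} {c : ℝ} (hc : 0 ≤ c) (x : n → ℝ) :
    M.qnorm (c • x) = c * M.qnorm x := by
  simp only [qnorm, mulVec_smul, smul_dotProduct, dotProduct_smul, smul_eq_mul]
  rw [← mul_assoc, Real.sqrt_mul (mul_nonneg hc hc), Real.sqrt_mul_self hc]

theorem PosDef.add_vecMulVec_self {V : Matrix n n ℝ} (hV : V.PosDef) (a : n → ℝ) :
    (V + vecMulVec a a).PosDef := by
  have : (vecMulVec a a).PosSemidef := by simpa using posSemidef_vecMulVec_self_star a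
  exact hV.add_posSemidef this

variable [DecidableEq n]

theorem PosDef.mul_inv {V : Matrix n n ℝ} (hV : V.PosDef) : V * V⁻¹ = 1 :=
  mul_nonsing_inv V ((isUnit_iff_isUnit_det V).1 hV.isUnit)

theorem PosDef.inv_mul {V : Matrix n n ℝ} (hV : V.PosDef) : V⁻¹ * V = 1 :=
  nonsing_inv_mul V ((isUnit_iff_isUnit_det V).1 hV.isUnit)

theorem PosDef.mulVec_inv_mulVec {V : Matrix n n ℝ} (hV : V.PosDef) (x : n → ℝ) :
    V *ᵥ (V⁻¹ *ᵥ x) = x := by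
  rw [mulVec_mulVec, hV.mul_inv, one_mulVec]

theorem PosDef.inv_mulVec_mulVec {V : Matrix n n ℝ} (hV : V.PosDef) (x : n → ℝ) :
    V⁻¹ *ᵥ (V *ᵥ x) = x := by
  rw [mulVec_mulVec, hV.inv_mul, one_mulVec]

theorem PosDef.qnorm_inv_mulVec {V : Matrix n n ℝ} (hV : V.PosDef) (x : n → ℝ) :
    V.qnorm (V⁻¹ *ᵥ x) = V⁻¹.qnorm x := by
  rw [qnorm, qnorm, hV.mulVec_inv_mulVec, dotProduct_comm]

/-- Cauchy–Schwarz for the form $V$, applied to $x$ and $V^{-1}y$. -/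
theorem PosDef.dotProduct_le_qnorm {V : Matrix n n ℝ} (hV : V.PosDef) (x y : n → ℝ) :
    x ⬝ᵥ y ≤ V.qnorm x * V⁻¹.qnorm y := by
  have := hV.posSemidef.dotProduct_mulVec_le x (V⁻¹ *ᵥ y)
  rwa [hV.mulVec_inv_mulVec, hV.qnorm_inv_mulVec] at this

theorem PosDef.det_add_vecMulVec_self {V : Matrix n n ℝ} (hV : V.PosDef) (a : n → ℝ) :
    (V + vecMulVec a a).det = V.det * (1 + a ⬝ᵥ (V⁻¹ *ᵥ a)) := by
  have h : V + vecMulVec a a = V * (1 + vecMulVec (V⁻¹ *ᵥ a) a) := by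
    rw [mul_add, mul_one, mul_vecMulVec, hV.mulVec_inv_mulVec]
  rw [h, det_mul, vecMulVec_eq Unit, det_one_add_replicateCol_mul_replicateRow]

theorem PosDef.quad_inv_add_vecMulVec_self {V : Matrix n n ℝ} (hV : V.PosDef) (a S : n → ℝ)
    (η : ℝ) :
    (S + η • a) ⬝ᵥ ((V + vecMulVec a a)⁻¹ *ᵥ (S + η • a)) =
      S ⬝ᵥ (V⁻¹ *ᵥ S) + (2 * η * (a ⬝ᵥ (V⁻¹ *ᵥ S)) + η ^ 2 * (a ⬝ᵥ (V⁻¹ *ᵥ a))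
        - (a ⬝ᵥ (V⁻¹ *ᵥ S)) ^ 2) / (1 + a ⬝ᵥ (V⁻¹ *ᵥ a)) := by
  have hw : 0 ≤ a ⬝ᵥ (V⁻¹ *ᵥ a) := hV.inv.posSemidef.quad_nonneg a
  set w := a ⬝ᵥ (V⁻¹ *ᵥ a) with hwd
  set s := a ⬝ᵥ (V⁻¹ *ᵥ S) with hsd
  -- With the ansatz $V^{-1}S+cV^{-1}a$ for the solution of $(V+aa^T)y=S+\eta a$, what remains is
  -- the scalar equation $c+s+cw=\eta$.
  set c := (η - s) / (1 + w) with hc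
  have hc' : c * (1 + w) = η - s := by rw [hc]; field_simp
  have hV' := hV.add_vecMulVec_self a
  have key : (V + vecMulVec a a) *ᵥ (V⁻¹ *ᵥ S + c • (V⁻¹ *ᵥ a)) = S + η • a := by
    rw [add_mulVec, mulVec_add, mulVec_smul, hV.mulVec_inv_mulVec, hV.mulVec_inv_mulVec,
      vecMulVec_mulVec, dotProduct_add, dotProduct_smul, ← hwd, ← hsd]
    ext i
    simp only [Pi.add_apply, Pi.smul_apply, smul_eq_mul, MulOpposite.smul_eq_mul_unop,
      MulOpposite.unop_op]
    linear_combination a i * hc'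
  rw [← key, hV'.inv_mulVec_mulVec, key]
  have hsym : S ⬝ᵥ (V⁻¹ *ᵥ a) = s := hV.inv.posSemidef.dotProduct_mulVec_swap _ _
  simp only [add_dotProduct, dotProduct_add, smul_dotProduct, dotProduct_smul, smul_eq_mul,
    ← hwd, ← hsd, hsym]
  rw [hc]
  field_simp
  ring

/-- The determinant is at most the `n`-th power of any upper bound on the mean eigenvalue. -/
theorem PosDef.log_det_le {V : Matrix n n ℝ} (hV : V.PosDef) {c : ℝ} (hc : 0 < c)
    (h : V.trace ≤ Fintype.card n * c) : Real.log V.det ≤ Fintype.card n * Real.log c := by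
  have hdet := hV.isHermitian.det_eq_prod_eigenvalues
  have htr := hV.isHermitian.trace_eq_sum_eigenvalues
  simp only [RCLike.ofReal_real_eq_id, id] at hdet htr
  rw [hdet, Real.log_prod fun i _ => (hV.eigenvalues_pos i).ne']
  -- The tangent line of the logarithm at $c$; summing it over the eigenvalues leaves only the
  -- trace.
  have h1 : ∀ i, Real.log (hV.isHermitian.eigenvalues i) ≤
      hV.isHermitian.eigenvalues i / c - 1 + Real.log c := by
    intro i
    have hp := hV.eigenvalues_pos i
    have := Real.log_le_sub_one_of_pos (div_pos hp hc)
    rw [Real.log_div hp.ne' hc.ne'] at this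
    linarith
  refine (Finset.sum_le_sum fun i _ => h1 i).trans ?_
  simp only [Finset.sum_add_distrib, Finset.sum_sub_distrib, Finset.sum_const, Finset.card_univ,
    nsmul_eq_mul, ← Finset.sum_div, ← htr]
  have : V.trace / c ≤ Fintype.card n := by rwa [div_le_iff₀ hc]
  linarith

end Matrix

/-! ### Gram matrices, self-normalised noise and the confidence set. -/

namespace LinUCB

variable {D t : ℕ}

theorem posDef_gram {lam : ℝ} (hlam : 0 < lam) (A : Fin t → Fin D → ℝ) : (gram lam A).PosDef := by
  refine (Matrix.PosDef.one.smul hlam).add_posSemidef (Matrix.posSemidef_sum _ fun s _ => ?_)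
  simpa using Matrix.posSemidef_vecMulVec_self_star (A s)

theorem gram_mulVec (lam : ℝ) (A : Fin t → Fin D → ℝ) (x : Fin D → ℝ) :
    gram lam A *ᵥ x = lam • x + ∑ s, (A s ⬝ᵥ x) • A s := by
  ext i
  simp only [gram, Matrix.add_mulVec, Matrix.smul_mulVec, Matrix.one_mulVec, Matrix.sum_mulVec,
    Matrix.vecMulVec_mulVec, Pi.add_apply, Finset.sum_apply, Pi.smul_apply, smul_eq_mul,
    MulOpposite.smul_eq_mul_unop, MulOpposite.unop_op, mul_comm]

theorem gram_succ (lam : ℝ) (A : Fin (t + 1) → Fin D → ℝ) :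
    gram lam A = gram lam (fun s : Fin t => A s.castSucc)
      + Matrix.vecMulVec (A (Fin.last t)) (A (Fin.last t)) := by
  simp only [gram, Fin.sum_univ_castSucc, add_assoc]

theorem trace_gram (lam : ℝ) (A : Fin t → Fin D → ℝ) :
    (gram lam A).trace = D * lam + ∑ s, A s ⬝ᵥ A s := by
  simp [gram, Matrix.trace_sum, Matrix.trace_vecMulVec, mul_comm]

/-- This is $V\ge\lambda I$ passed to inverses: for $y=V^{-1}x$ one has $\lambda|y|^2\le\langle
x,y\rangle$, to be combined with $|x-\lambda y|^2\ge 0$. -/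
theorem quad_inv_gram_le {lam : ℝ} (hlam : 0 < lam) (A : Fin t → Fin D → ℝ) (x : Fin D → ℝ) :
    x ⬝ᵥ ((gram lam A)⁻¹ *ᵥ x) ≤ (x ⬝ᵥ x) / lam := by
  have hV := posDef_gram hlam A
  set y := (gram lam A)⁻¹ *ᵥ x with hy
  have h1 : y ⬝ᵥ (gram lam A *ᵥ y) = x ⬝ᵥ y := by
    rw [hy, hV.mulVec_inv_mulVec, dotProduct_comm]
  have h2 : lam * (y ⬝ᵥ y) ≤ x ⬝ᵥ y := by
    rw [← h1, gram_mulVec, dotProduct_add, dotProduct_smul, smul_eq_mul, dotProduct_sum]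
    refine le_add_of_nonneg_right (Finset.sum_nonneg fun s _ => ?_)
    rw [dotProduct_smul, dotProduct_comm y, smul_eq_mul]
    exact mul_self_nonneg _
  have h3 : 0 ≤ (x - lam • y) ⬝ᵥ (x - lam • y) :=
    Finset.sum_nonneg fun i _ => mul_self_nonneg _
  simp only [sub_dotProduct, dotProduct_sub, smul_dotProduct, dotProduct_smul, smul_eq_mul,
    dotProduct_comm y x] at h3
  rw [le_div_iff₀ hlam]
  nlinarith

/-- The trace is at most $D\lambda+nL^2$, and the arithmetic-geometric mean inequality turns this
into a determinant bound. The right side is the term in the confidence radius and also the total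
elliptical potential. -/
theorem log_det_gram_le {lam : ℝ} (hlam : 0 < lam) (hD : 0 < D) {n : ℕ} (htn : t ≤ n) {L : ℝ}
    (A : Fin t → Fin D → ℝ) (hA : ∀ s, A s ⬝ᵥ A s ≤ L ^ 2) :
    Real.log (gram lam A).det - D * Real.log lam ≤
      D * Real.log ((D * lam + n * L ^ 2) / (D * lam)) := by
  have hD' : (0 : ℝ) < D := by exact_mod_cast hD
  have hc : 0 < D * lam + n * L ^ 2 := by positivity
  have h := (posDef_gram hlam A).log_det_le (c := (D * lam + n * L ^ 2) / D) (by positivity) (by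
    rw [trace_gram, Fintype.card_fin, mul_div_cancel₀ _ hD'.ne']
    have h1 : ∑ s, A s ⬝ᵥ A s ≤ t * L ^ 2 :=
      (Finset.sum_le_sum fun s _ => hA s).trans (by simp)
    have h2 : (t : ℝ) * L ^ 2 ≤ n * L ^ 2 := by gcongr
    linarith)
  rw [Fintype.card_fin, Real.log_div hc.ne' hD'.ne'] at h
  rw [Real.log_div hc.ne' (by positivity), Real.log_mul hD'.ne' hlam.ne']
  linarith

theorem le_log_det_gram {lam : ℝ} (hlam : 0 < lam) (A : Fin t → Fin D → ℝ) :
    D * Real.log lam ≤ Real.log (gram lam A).det := by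
  rw [← Real.log_pow]
  refine Real.log_le_log (pow_pos hlam _) ?_
  induction t with
  | zero => simp [gram]
  | succ t ih =>
    have hV := posDef_gram hlam (fun s : Fin t => A s.castSucc)
    rw [gram_succ, hV.det_add_vecMulVec_self]
    refine (ih fun s : Fin t => A s.castSucc).trans ?_
    exact le_mul_of_one_le_right hV.det_pos.le
      (le_add_of_nonneg_right (hV.inv.posSemidef.quad_nonneg _))

/-- The deviation of the estimator from a parameter `θ` in terms of the noise `X s - ⟨A s, θ⟩`. -/
theorem gram_mulVec_estimator_sub {lam : ℝ} (hlam : 0 < lam) (A : Fin t → Fin D → ℝ)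
    (X : Fin t → ℝ) (θ : Fin D → ℝ) :
    gram lam A *ᵥ (estimator lam A X - θ) = ∑ s, (X s - A s ⬝ᵥ θ) • A s - lam • θ := by
  rw [Matrix.mulVec_sub, estimator, (posDef_gram hlam A).mulVec_inv_mulVec, gram_mulVec]
  simp only [sub_smul, Finset.sum_sub_distrib]
  abel

/-- The noise vector `∑ₛ (Xₛ - ⟨Aₛ, θ⟩) Aₛ`. -/
def noise (θ : Fin D → ℝ) (A : Fin t → Fin D → ℝ) (X : Fin t → ℝ) : Fin D → ℝ :=
  ∑ s, (X s - A s ⬝ᵥ θ) • A s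

/-- The exponential of the self-normalised noise,
`√(λ^D / det V_t) exp (‖S_t‖²_{V_t⁻¹} / 2)`. -/
def selfNormalizedExp (lam : ℝ) (θ : Fin D → ℝ) (A : Fin t → Fin D → ℝ) (X : Fin t → ℝ) : ℝ :=
  Real.exp ((noise θ A X ⬝ᵥ ((gram lam A)⁻¹ *ᵥ noise θ A X)) / 2
    - (Real.log (gram lam A).det - D * Real.log lam) / 2)

/-- Since $V(\hat\theta-\theta)=S-\lambda\theta$, the error splits into the noise and the bias due
to regularisation. -/
theorem qnorm_estimator_sub_le {lam : ℝ} (hlam : 0 < lam) (A : Fin t → Fin D → ℝ)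
    (X : Fin t → ℝ) (θ : Fin D → ℝ) :
    (gram lam A).qnorm (θ - estimator lam A X) ≤
      (gram lam A)⁻¹.qnorm (noise θ A X) + √lam * √(θ ⬝ᵥ θ) := by
  have hV := posDef_gram hlam A
  have h : estimator lam A X - θ = (gram lam A)⁻¹ *ᵥ (noise θ A X - lam • θ) := by
    rw [noise, ← gram_mulVec_estimator_sub hlam, hV.inv_mulVec_mulVec]
  rw [← neg_sub, Matrix.qnorm_neg, h, hV.qnorm_inv_mulVec]
  refine (hV.inv.posSemidef.qnorm_sub_le _ _).trans (add_le_add_right ?_ _)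
  rw [Matrix.qnorm_smul hlam.le]
  have h1 := Real.sqrt_le_sqrt (quad_inv_gram_le hlam A θ)
  calc lam * (gram lam A)⁻¹.qnorm θ ≤ lam * √((θ ⬝ᵥ θ) / lam) := by
        unfold Matrix.qnorm; gcongr
    _ = √lam * √(θ ⬝ᵥ θ) := by
        rw [Real.sqrt_div' _ hlam.le]
        have := Real.mul_self_sqrt hlam.le
        have h0 : √lam ≠ 0 := (Real.sqrt_pos.2 hlam).ne'
        field_simp
        rw [sq, this, mul_comm]

/-- Outside of the confidence set the self-normalised noise is large. -/
theorem lt_selfNormalizedExp {lam : ℝ} (hlam : 0 < lam) (hD : 0 < D) {n : ℕ} (htn : t ≤ n)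
    {m L δ : ℝ} (hδ : 0 < δ) (A : Fin t → Fin D → ℝ) (hA : ∀ s, A s ⬝ᵥ A s ≤ L ^ 2)
    (X : Fin t → ℝ) (θ : Fin D → ℝ) (hθ : √(θ ⬝ᵥ θ) ≤ m)
    (h : θ ∉ confidenceSet n lam m L δ A X) : 1 / δ < selfNormalizedExp lam θ A X := by
  have hV := posDef_gram hlam A
  simp only [confidenceSet, Set.mem_ofPred_eq, not_le, radius] at h
  have h1 := h.trans_le (qnorm_estimator_sub_le hlam A X θ)
  have h2 : √lam * √(θ ⬝ᵥ θ) ≤ m * √lam := by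
    rw [mul_comm]; gcongr
  have h3 : √(2 * Real.log (1 / δ) + D * Real.log ((D * lam + n * L ^ 2) / (D * lam))) <
      (gram lam A)⁻¹.qnorm (noise θ A X) := by linarith
  rw [Matrix.qnorm] at h3
  have h4 : 2 * Real.log (1 / δ) + D * Real.log ((D * lam + n * L ^ 2) / (D * lam)) <
      noise θ A X ⬝ᵥ ((gram lam A)⁻¹ *ᵥ noise θ A X) := by
    by_contra hcon
    exact absurd h3 (not_lt.2 (Real.sqrt_le_sqrt (not_lt.1 hcon)))
  have h5 := log_det_gram_le hlam hD htn A hA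
  rw [selfNormalizedExp, ← Real.log_lt_iff_lt_exp (by positivity)]
  linarith

theorem noise_succ (θ : Fin D → ℝ) (A : Fin (t + 1) → Fin D → ℝ) (X : Fin (t + 1) → ℝ) :
    noise θ A X = noise θ (fun s : Fin t => A s.castSucc) (fun s => X s.castSucc)
      + (X (Fin.last t) - A (Fin.last t) ⬝ᵥ θ) • A (Fin.last t) := by
  simp only [noise, Fin.sum_univ_castSucc]

/-- Combines the rank-one updates of the inverse quadratic form and of the determinant. The data
$a,V,S,\eta$ enter through equations so that the factor can be stated in terms of the history before
it is extended. -/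
theorem selfNormalizedExp_succ {lam : ℝ} (hlam : 0 < lam) (θ : Fin D → ℝ)
    (A : Fin (t + 1) → Fin D → ℝ) (X : Fin (t + 1) → ℝ) {a : Fin D → ℝ}
    (ha : A (Fin.last t) = a) {V : Matrix (Fin D) (Fin D) ℝ}
    (hVA : V = gram lam fun s : Fin t => A s.castSucc) {S : Fin D → ℝ}
    (hS : S = noise θ (fun s : Fin t => A s.castSucc) (fun s => X s.castSucc)) {η : ℝ}
    (hη : η = X (Fin.last t) - a ⬝ᵥ θ) :
    selfNormalizedExp lam θ A X =
      selfNormalizedExp lam θ (fun s : Fin t => A s.castSucc) (fun s => X s.castSucc) *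
      (Real.exp ((2 * η * (a ⬝ᵥ (V⁻¹ *ᵥ S)) + η ^ 2 * (a ⬝ᵥ (V⁻¹ *ᵥ a))
        - (a ⬝ᵥ (V⁻¹ *ᵥ S)) ^ 2) / (2 * (1 + a ⬝ᵥ (V⁻¹ *ᵥ a)))
        - Real.log (1 + a ⬝ᵥ (V⁻¹ *ᵥ a)) / 2)) := by
  have hV : V.PosDef := hVA ▸ posDef_gram hlam _
  have hw := hV.inv.posSemidef.quad_nonneg a
  rw [selfNormalizedExp, selfNormalizedExp, gram_succ, noise_succ, ha, ← hVA, ← hS, ← hη,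
    hV.quad_inv_add_vecMulVec_self, hV.det_add_vecMulVec_self,
    Real.log_mul hV.det_pos.ne' (by positivity), ← Real.exp_add]
  congr 1
  field_simp
  ring

/-! ### Optimism -/

theorem radius_nonneg (D n : ℕ) {lam m L δ : ℝ} (hm : 0 ≤ m) : 0 ≤ radius D n lam m L δ :=
  add_nonneg (mul_nonneg hm (Real.sqrt_nonneg _)) (Real.sqrt_nonneg _)

/-- The largest value of `⟨θ, a⟩` over the confidence set. -/
def ucb (n : ℕ) (lam m L δ : ℝ) (A : Fin t → Fin D → ℝ) (X : Fin t → ℝ) (a : Fin D → ℝ) : ℝ :=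
  estimator lam A X ⬝ᵥ a + radius D n lam m L δ * (gram lam A)⁻¹.qnorm a

theorem dotProduct_le_ucb {lam : ℝ} (hlam : 0 < lam) (n : ℕ) {m L δ : ℝ}
    (A : Fin t → Fin D → ℝ) (X : Fin t → ℝ) (a θ : Fin D → ℝ)
    (hθ : θ ∈ confidenceSet n lam m L δ A X) : θ ⬝ᵥ a ≤ ucb n lam m L δ A X a := by
  have h := (posDef_gram hlam A).dotProduct_le_qnorm (θ - estimator lam A X) a
  have h2 : (gram lam A).qnorm (θ - estimator lam A X) * (gram lam A)⁻¹.qnorm a ≤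
      radius D n lam m L δ * (gram lam A)⁻¹.qnorm a :=
    mul_le_mul_of_nonneg_right hθ (Matrix.qnorm_nonneg _ _)
  rw [sub_dotProduct] at h
  rw [ucb]
  linarith

theorem exists_dotProduct_eq_ucb {lam : ℝ} (hlam : 0 < lam) (n : ℕ) {m L δ : ℝ} (hm : 0 ≤ m)
    (A : Fin t → Fin D → ℝ) (X : Fin t → ℝ) (a : Fin D → ℝ) :
    ∃ θ ∈ confidenceSet n lam m L δ A X, θ ⬝ᵥ a = ucb n lam m L δ A X a := by
  have hV := posDef_gram hlam A
  have hβ := radius_nonneg D n (lam := lam) (L := L) (δ := δ) hm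
  set q := (gram lam A)⁻¹.qnorm a with hq
  have hq0 : 0 ≤ q := Matrix.qnorm_nonneg _ _
  have hsq : ((gram lam A)⁻¹ *ᵥ a) ⬝ᵥ a = q ^ 2 := by
    rw [hq, hV.inv.posSemidef.qnorm_sq, dotProduct_comm]
  -- The boundary point of the ellipsoid in the direction $V^{-1}a$. If $q=0$, division by zero
  -- makes it the centre, which is then a maximiser.
  refine ⟨estimator lam A X + (radius D n lam m L δ / q) • ((gram lam A)⁻¹ *ᵥ a), ?_, ?_⟩
  · change (gram lam A).qnorm _ ≤ _
    rw [add_sub_cancel_left, Matrix.qnorm_smul (div_nonneg hβ hq0),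
      hV.qnorm_inv_mulVec, ← hq]
    rcases hq0.eq_or_lt with h | h
    · simpa [← h] using hβ
    · rw [div_mul_cancel₀ _ h.ne']
  · rw [ucb, add_dotProduct, smul_dotProduct, smul_eq_mul, hsq, ← hq]
    rcases hq0.eq_or_lt with h | h
    · simp [← h]
    · field_simp

/-! ### Continuity in the actions and rewards. -/

theorem continuous_gram (lam : ℝ) :
    Continuous fun A : Fin t → Fin D → ℝ => gram lam A := by
  unfold gram
  refine continuous_const.add (continuous_finsetSum _ fun s _ => ?_)
  exact Continuous.matrix_vecMulVec (continuous_apply s) (continuous_apply s)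

theorem continuous_inv_gram {lam : ℝ} (hlam : 0 < lam) :
    Continuous fun A : Fin t → Fin D → ℝ => (gram lam A)⁻¹ := by
  simp only [Matrix.inv_def, Ring.inverse_eq_inv']
  exact ((continuous_gram lam).matrix_det.inv₀ fun A => (posDef_gram hlam A).det_pos.ne').smul
    (continuous_gram lam).matrix_adjugate

theorem continuous_estimator {lam : ℝ} (hlam : 0 < lam) :
    Continuous fun p : (Fin t → Fin D → ℝ) × (Fin t → ℝ) => estimator lam p.1 p.2 := by
  unfold estimator
  refine ((continuous_inv_gram hlam).comp continuous_fst).matrix_mulVec ?_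
  fun_prop

theorem continuous_qnorm_inv_gram {lam : ℝ} (hlam : 0 < lam) :
    Continuous fun p : (Fin t → Fin D → ℝ) × (Fin D → ℝ) => (gram lam p.1)⁻¹.qnorm p.2 := by
  unfold Matrix.qnorm
  exact (continuous_snd.dotProduct
    (((continuous_inv_gram hlam).comp continuous_fst).matrix_mulVec continuous_snd)).sqrt

theorem continuous_ucb {lam : ℝ} (hlam : 0 < lam) (n : ℕ) (m L δ : ℝ) :
    Continuous fun p : ((Fin t → Fin D → ℝ) × (Fin t → ℝ)) × (Fin D → ℝ) =>
      ucb n lam m L δ p.1.1 p.1.2 p.2 := by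
  unfold ucb
  refine (((continuous_estimator hlam).comp continuous_fst).dotProduct continuous_snd).add
    (continuous_const.mul ?_)
  exact (continuous_qnorm_inv_gram hlam).comp
    ((continuous_fst.comp continuous_fst).prodMk continuous_snd)

theorem continuous_noise (θ : Fin D → ℝ) :
    Continuous fun p : (Fin t → Fin D → ℝ) × (Fin t → ℝ) => noise θ p.1 p.2 := by
  unfold noise
  refine continuous_finsetSum _ fun s _ => ?_
  have h1 : Continuous fun p : (Fin t → Fin D → ℝ) × (Fin t → ℝ) => p.1 s := by fun_prop
  exact Continuous.smul (Continuous.sub (by fun_prop) (h1.dotProduct continuous_const)) h1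

theorem continuous_log_det_gram {lam : ℝ} (hlam : 0 < lam) :
    Continuous fun A : Fin t → Fin D → ℝ => Real.log (gram lam A).det :=
  (continuous_gram lam).matrix_det.log fun A => (posDef_gram hlam A).det_pos.ne'

theorem continuous_selfNormalizedExp {lam : ℝ} (hlam : 0 < lam) (θ : Fin D → ℝ) :
    Continuous fun p : (Fin t → Fin D → ℝ) × (Fin t → ℝ) => selfNormalizedExp lam θ p.1 p.2 := by
  unfold selfNormalizedExp
  refine Real.continuous_exp.comp (Continuous.sub ?_ ?_)
  · exact ((continuous_noise θ).dotProduct (((continuous_inv_gram hlam).comp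
      continuous_fst).matrix_mulVec (continuous_noise θ))).div_const 2
  · exact ((((continuous_log_det_gram hlam).comp continuous_fst).sub
      continuous_const)).div_const 2

end LinUCB

/-! ### Measurable selection of maximisers -/

/-- The set of parameters for which some maximiser lies in a given closed set is measurable. -/
theorem measurableSet_exists_isMax {H E : Type*} [MeasurableSpace H] [TopologicalSpace E]
    [CompactSpace E] [SecondCountableTopology E] {g : H → E → ℝ}
    (hm : ∀ e, Measurable fun h => g h e) (hc : ∀ h, Continuous (g h)) {F : Set E}
    (hF : IsClosed F) : MeasurableSet {h | ∃ x ∈ F, ∀ y, g h y ≤ g h x} := by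
  rcases F.eq_empty_or_nonempty with rfl | hne
  · simp
  obtain ⟨u, huc, hu⟩ := TopologicalSpace.exists_countable_dense E
  obtain ⟨v, hvc, hv⟩ := TopologicalSpace.exists_countable_dense F
  -- By compactness $g(h,\cdot)$ attains its maximum on $F$. So it suffices that each $y$ of a dense
  -- set is beaten up to each $1/(m+1)$ by some point of $F$, which may depend on $y$ and $m$; only
  -- countably many conditions remain.
  have key : {h | ∃ x ∈ F, ∀ y, g h y ≤ g h x} =
      ⋂ y ∈ u, ⋂ m : ℕ, ⋃ x ∈ v, {h | g h y < g h (x : E) + 1 / ((m : ℝ) + 1)} := by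
    ext h
    simp only [Set.mem_ofPred_eq, Set.mem_iInter, Set.mem_iUnion]
    constructor
    · rintro ⟨x, hx, hmax⟩ y - m
      have hpos : 0 < 1 / ((m : ℝ) + 1) := by positivity
      have hopen : IsOpen {z : F | g h y < g h z + 1 / ((m : ℝ) + 1)} :=
        isOpen_lt continuous_const
          (((hc h).comp continuous_subtype_val).add continuous_const)
      obtain ⟨z, hz, hzv⟩ := hv.exists_mem_open hopen ⟨⟨x, hx⟩, by
        have := hmax y
        simp only [Set.mem_ofPred_eq]
        linarith⟩
      exact ⟨z, hz, hzv⟩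
    · intro hh
      obtain ⟨x, hx, hxmax⟩ := hF.isCompact.exists_isMaxOn hne (hc h).continuousOn
      refine ⟨x, hx, fun y => ?_⟩
      have hle : ∀ y ∈ u, g h y ≤ g h x := by
        intro y hy
        refine le_of_forall_pos_lt_add fun ε hε => ?_
        obtain ⟨m, hm⟩ := exists_nat_one_div_lt hε
        obtain ⟨z, -, hz⟩ := hh y hy m
        have : g h z ≤ g h x := hxmax z.2
        linarith
      exact hu.induction (P := fun y => g h y ≤ g h x) hle
        (isClosed_le (hc h) continuous_const) y
  rw [key]
  refine MeasurableSet.biInter huc fun y _ => MeasurableSet.iInter fun m =>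
    MeasurableSet.biUnion hvc fun x _ => ?_
  exact measurableSet_lt (hm y) ((hm x).add_const _)

/-- A function that is measurable in the parameter and continuous in a variable ranging over a
compact metrizable space has a measurable selection of maximisers. -/
theorem exists_measurable_isMax {H K : Type*} [MeasurableSpace H] [TopologicalSpace K]
    [TopologicalSpace.MetrizableSpace K] [CompactSpace K] [Nonempty K] [MeasurableSpace K] [BorelSpace K] {g : H → K → ℝ}
    (hm : ∀ k, Measurable fun h => g h k) (hc : ∀ h, Continuous (g h)) :
    ∃ s : H → K, Measurable s ∧ ∀ h k, g h k ≤ g h (s h) := by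
  let := TopologicalSpace.metrizableSpaceMetric K
  -- Lifting to Cantor space, which embeds in $\mathbb R$ by `ψ`, provides an order in which the
  -- least maximiser is a canonical choice.
  obtain ⟨φ, hφ, hφs⟩ := exists_nat_bool_continuous_surjective_of_compact K
  let ψ : (ℕ → Bool) → ℝ := fun e => (cantorSetHomeomorphNatToBool.symm e : ℝ)
  have hψ : Continuous ψ :=
    continuous_subtype_val.comp cantorSetHomeomorphNatToBool.symm.continuous
  have hψi : Function.Injective ψ :=
    Subtype.val_injective.comp cantorSetHomeomorphNatToBool.symm.injective
  have hψe : MeasurableEmbedding ψ := (hψ.isClosedEmbedding hψi).measurableEmbedding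
  have hf : ∀ h, Continuous fun e => g h (φ e) := fun h => (hc h).comp hφ
  have hex : ∀ h, ∃ e : ℕ → Bool, (∀ y, g h (φ y) ≤ g h (φ e)) ∧
      ∀ e', (∀ y, g h (φ y) ≤ g h (φ e')) → ψ e ≤ ψ e' := by
    intro h
    obtain ⟨e₀, -, he₀⟩ := isCompact_univ.exists_isMaxOn Set.univ_nonempty (hf h).continuousOn
    have hcl : IsClosed {e : ℕ → Bool | ∀ y, g h (φ y) ≤ g h (φ e)} := by
      simp only [Set.ofPred_forall]
      exact isClosed_iInter fun y => isClosed_le continuous_const (hf h)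
    obtain ⟨e, he, hmin⟩ := hcl.isCompact.exists_isMinOn
      ⟨e₀, fun y => he₀ (Set.mem_univ y)⟩ hψ.continuousOn
    exact ⟨e, he, fun e' he' => hmin he'⟩
  choose e he hmin using hex
  have hme : Measurable e := by
    rw [← hψe.measurable_comp_iff]
    refine measurable_of_Iic fun c => ?_
    -- The least maximiser is at most $c$ exactly when some maximiser lies in the closed set
    -- $\{\psi\le c\}$.
    have : (ψ ∘ e) ⁻¹' Set.Iic c =
        {h | ∃ x ∈ ψ ⁻¹' Set.Iic c, ∀ y, g h (φ y) ≤ g h (φ x)} := by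
      ext h
      exact ⟨fun hh => ⟨e h, hh, he h⟩, fun ⟨x, hx, hmax⟩ => (hmin h x hmax).trans hx⟩
    rw [this]
    exact measurableSet_exists_isMax (fun x => hm (φ x)) hf (isClosed_Iic.preimage hψ)
  refine ⟨φ ∘ e, hφ.measurable.comp hme, fun h k => ?_⟩
  obtain ⟨y, rfl⟩ := hφs k
  exact he h y

/-! ### Spectral decomposition and Born's rule -/

section Spectral

variable {d : ℕ} {O : Matrix (Fin d) (Fin d) ℂ}

theorem eq_sum_eigenvalues_smul_rankOne (hO : O.IsHermitian) :
    O = ∑ i, (hO.eigenvalues i : ℂ) • Matrix.vecMulVec (hO.eigenvectorBasis i)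
      (star (hO.eigenvectorBasis i : Fin d → ℂ)) := by
  conv_lhs => rw [← mul_one O, ← sum_rankOne_eigenvectors hO, Finset.mul_sum]
  refine Finset.sum_congr rfl fun i _ => ?_
  rw [Matrix.mul_vecMulVec, hO.mulVec_eigenvectorBasis, ← Matrix.smul_vecMulVec]
  rfl

theorem trace_rankOne_eigenvector (hO : O.IsHermitian) (i : Fin d) :
    (Matrix.vecMulVec (hO.eigenvectorBasis i)
      (star (hO.eigenvectorBasis i : Fin d → ℂ))).trace = 1 := by
  have h := hO.eigenvectorBasis.orthonormal.1 i
  have h2 : inner ℂ (hO.eigenvectorBasis i) (hO.eigenvectorBasis i) = 1 := by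
    rw [inner_self_eq_norm_sq_to_K, h]; simp
  rw [Matrix.trace_vecMulVec, ← h2, EuclideanSpace.inner_eq_star_dotProduct]

theorem trace_mul_eq_sum_eigenvalues (hO : O.IsHermitian) (M : Matrix (Fin d) (Fin d) ℂ) :
    (M * O).trace = ∑ i, (hO.eigenvalues i : ℂ) * (M * Matrix.vecMulVec (hO.eigenvectorBasis i)
      (star (hO.eigenvectorBasis i : Fin d → ℂ))).trace := by
  conv_lhs => rw [eq_sum_eigenvalues_smul_rankOne hO]
  simp [Finset.mul_sum, Matrix.trace_sum]

theorem expect_eq_sum_eigenvalues (hO : O.IsHermitian) (ρ : QState d) :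
    ρ.expect O = ∑ i, hO.eigenvalues i * ρ.expect (Matrix.vecMulVec (hO.eigenvectorBasis i)
      (star (hO.eigenvectorBasis i : Fin d → ℂ))) := by
  simp [QState.expect, trace_mul_eq_sum_eigenvalues hO]

theorem trace_sq_eq_sum_eigenvalues_sq (hO : O.IsHermitian) :
    (O * O).trace.re = ∑ i, hO.eigenvalues i ^ 2 := by
  rw [trace_mul_eq_sum_eigenvalues hO, Complex.re_sum]
  refine Finset.sum_congr rfl fun i _ => ?_
  rw [Matrix.mul_vecMulVec, hO.mulVec_eigenvectorBasis, Matrix.smul_vecMulVec, Matrix.trace_smul,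
    trace_rankOne_eigenvector hO]
  simp [sq]

theorem abs_eigenvalues_le (hO : O.IsHermitian)
    (hn : ‖Matrix.toEuclideanCLM (n := Fin d) (𝕜 := ℂ) O‖ ≤ 1) (i : Fin d) :
    |hO.eigenvalues i| ≤ 1 := by
  have h1 := (Matrix.toEuclideanCLM (n := Fin d) (𝕜 := ℂ) O).le_opNorm (hO.eigenvectorBasis i)
  have h2 : Matrix.toEuclideanCLM (n := Fin d) (𝕜 := ℂ) O (hO.eigenvectorBasis i) =
      hO.eigenvalues i • hO.eigenvectorBasis i := by
    apply (WithLp.ofLp_injective 2)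
    simpa using hO.mulVec_eigenvectorBasis i
  rw [h2, norm_smul, hO.eigenvectorBasis.orthonormal.1 i] at h1
  simp only [Real.norm_eq_abs, mul_one] at h1
  exact h1.trans hn

theorem trace_sq_le (hO : O.IsHermitian)
    (hn : ‖Matrix.toEuclideanCLM (n := Fin d) (𝕜 := ℂ) O‖ ≤ 1) : (O * O).trace.re ≤ d := by
  rw [trace_sq_eq_sum_eigenvalues_sq hO]
  refine (Finset.sum_le_sum fun i _ => (sq_le_one_iff_abs_le_one _).2
    (abs_eigenvalues_le hO hn i)).trans ?_
  simp

/-- The eigenvalues lie in $[0,1]$ and sum to one, so squaring does not increase them. -/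
theorem QState.trace_sq_le_one (ρ : QState d) : (ρ.1 * ρ.1).trace.re ≤ 1 := by
  have hO := ρ.2.1.isHermitian
  have htr : ∑ i, hO.eigenvalues i = 1 := by
    have h := hO.trace_eq_sum_eigenvalues
    rw [ρ.2.2] at h
    simpa using (congrArg Complex.re h).symm
  have hnn := ρ.2.1.eigenvalues_nonneg
  rw [trace_sq_eq_sum_eigenvalues_sq hO, ← htr]
  refine Finset.sum_le_sum fun i _ => ?_
  have : hO.eigenvalues i ≤ 1 := htr ▸ Finset.single_le_sum (fun j _ => hnn j) (Finset.mem_univ i)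
  have h0 : 0 ≤ hO.eigenvalues i := hnn i
  nlinarith

theorem ae_bornMeasure (ρ : QState d) (hO : O.IsHermitian) :
    ∀ᵐ x ∂(bornMeasure ρ hO), x ∈ eigenvalueSet hO := by
  rw [ae_iff, bornMeasure, Measure.coe_finsetSum, Finset.sum_apply]
  refine Finset.sum_eq_zero fun x hx => ?_
  have hm : MeasurableSet {a : ℝ | a ∉ eigenvalueSet hO} :=
    (Finset.measurableSet (eigenvalueSet hO)).compl
  rw [Measure.smul_apply, Measure.dirac_apply' _ hm]
  simp [hx]

theorem ae_bornMeasure_mem_Icc (ρ : QState d) (hO : O.IsHermitian)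
    (hn : ‖Matrix.toEuclideanCLM (n := Fin d) (𝕜 := ℂ) O‖ ≤ 1) :
    ∀ᵐ x ∂(bornMeasure ρ hO), x ∈ Set.Icc (-1 : ℝ) 1 := by
  filter_upwards [ae_bornMeasure ρ hO] with x hx
  obtain ⟨i, -, rfl⟩ := Finset.mem_image.1 hx
  exact abs_le.1 (abs_eigenvalues_le hO hn i)

/-- The mean of the outcome is `Tr (ρ O)`. -/
theorem integral_bornMeasure (ρ : QState d) (hO : O.IsHermitian) :
    ∫ x, x ∂(bornMeasure ρ hO) = ρ.expect O := by
  rw [bornMeasure, integral_finsetSum_measure fun x _ =>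
    (integrable_dirac (by simp)).smul_measure ENNReal.ofReal_ne_top]
  have hterm : ∀ x ∈ eigenvalueSet hO,
      ∫ y, y ∂(ENNReal.ofReal (ρ.expect (spectralProj hO x)) • Measure.dirac x) =
      ∑ i with hO.eigenvalues i = x, hO.eigenvalues i *
        ρ.expect (Matrix.vecMulVec (hO.eigenvectorBasis i)
          (star (hO.eigenvectorBasis i : Fin d → ℂ))) := by
    intro x _
    have hnn : 0 ≤ ρ.expect (spectralProj hO x) := by
      rw [spectralProj, expect_sum]
      exact Finset.sum_nonneg fun i _ => expect_rankOne_nonneg ρ _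
    rw [integral_smul_measure, integral_dirac, ENNReal.toReal_ofReal hnn, spectralProj,
      expect_sum, smul_eq_mul, mul_comm, Finset.mul_sum]
    refine Finset.sum_congr rfl fun i hi => ?_
    rw [(Finset.mem_filter.1 hi).2]
  rw [Finset.sum_congr rfl hterm, expect_eq_sum_eigenvalues hO]
  exact Finset.sum_fiberwise_of_maps_to
    (fun i _ => Finset.mem_image_of_mem _ (Finset.mem_univ i)) _

theorem abs_expect_le (ρ : QState d) (hO : O.IsHermitian)
    (hn : ‖Matrix.toEuclideanCLM (n := Fin d) (𝕜 := ℂ) O‖ ≤ 1) : |ρ.expect O| ≤ 1 := by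
  have := isProbabilityMeasure_bornMeasure ρ hO
  rw [← integral_bornMeasure ρ hO, ← Real.norm_eq_abs]
  refine (norm_integral_le_of_norm_le_const (C := 1) ?_).trans (by simp)
  filter_upwards [ae_bornMeasure_mem_Icc ρ hO hn] with x hx
  exact abs_le.2 hx

/-- The pure state of an eigenvector. -/
def eigenstate (hO : O.IsHermitian) (i : Fin d) : QState d :=
  ⟨Matrix.vecMulVec (hO.eigenvectorBasis i) (star (hO.eigenvectorBasis i : Fin d → ℂ)),
    Matrix.posSemidef_vecMulVec_self_star _, trace_rankOne_eigenvector hO i⟩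

end Spectral

/-! ### Coordinates -/

namespace HermitianBasis

variable {d : ℕ} (σ : HermitianBasis d)

theorem linearIndependent : LinearIndependent ℂ σ.mat := by
  rw [Fintype.linearIndependent_iff]
  intro c hc i
  have h : ((∑ j, c j • σ.mat j) * σ.mat i).trace = c i := by
    simp [Finset.sum_mul, Matrix.trace_sum, σ.orthonormal]
  rw [← h, hc]
  simp

/-- Independence and the count $d^2=\dim_{\mathbb C}\mathbb C^{d\times d}$ make the $\sigma_i$ a
basis; orthonormality identifies the coefficients. -/
theorem eq_sum_trace_smul (X : Matrix (Fin d) (Fin d) ℂ) :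
    X = ∑ i, (X * σ.mat i).trace • σ.mat i := by
  have hspan : Submodule.span ℂ (Set.range σ.mat) = ⊤ :=
    σ.linearIndependent.span_eq_top_of_card_eq_finrank' (by
      simp [Module.finrank_matrix, sq])
  have hX : X ∈ Submodule.span ℂ (Set.range σ.mat) := hspan ▸ Submodule.mem_top
  obtain ⟨c, rfl⟩ := (Submodule.mem_span_range_iff_exists_fun ℂ).1 hX
  refine Finset.sum_congr rfl fun i _ => ?_
  simp [Finset.sum_mul, Matrix.trace_sum, σ.orthonormal]

theorem ofReal_coord {X : Matrix (Fin d) (Fin d) ℂ} (hX : X.IsHermitian) (i : Fin (d ^ 2)) :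
    (σ.coord X i : ℂ) = (X * σ.mat i).trace := by
  refine Complex.conj_eq_iff_re.1 ?_
  rw [starRingEnd_apply, ← Matrix.trace_conjTranspose, Matrix.conjTranspose_mul, hX.eq,
    (σ.isHermitian i).eq, Matrix.trace_mul_comm]

theorem coord_dotProduct_coord {X Y : Matrix (Fin d) (Fin d) ℂ} (hX : X.IsHermitian)
    (hY : Y.IsHermitian) : σ.coord X ⬝ᵥ σ.coord Y = (X * Y).trace.re := by
  have h : ((σ.coord X ⬝ᵥ σ.coord Y : ℝ) : ℂ) = (X * Y).trace := by
    conv_rhs => rw [σ.eq_sum_trace_smul X, Finset.sum_mul, Matrix.trace_sum]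
    rw [dotProduct, Complex.ofReal_sum]
    refine Finset.sum_congr rfl fun i _ => ?_
    rw [Complex.ofReal_mul, σ.ofReal_coord hX, σ.ofReal_coord hY, Matrix.smul_mul,
      Matrix.trace_smul, smul_eq_mul, Matrix.trace_mul_comm Y]
  rw [← h, Complex.ofReal_re]

theorem coord_dotProduct_state (ρ : QState d) {O : Matrix (Fin d) (Fin d) ℂ}
    (hO : O.IsHermitian) : σ.coord O ⬝ᵥ σ.coord ρ.1 = ρ.expect O := by
  rw [dotProduct_comm, σ.coord_dotProduct_coord ρ.2.1.isHermitian hO, QState.expect]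

theorem continuous_coord : Continuous σ.coord := by
  unfold coord
  refine continuous_pi fun i => Complex.continuous_re.comp ?_
  exact (continuous_id.matrix_mul continuous_const).matrix_trace

end HermitianBasis

theorem QuantumBandit.measurable_expect {d : ℕ} (B : QuantumBandit d) (ρ : QState d) :
    Measurable fun a : B.Arm => ρ.expect a.1 := by
  have h := (measurable_id.stronglyMeasurable (α := ℝ)).integral_kernel (κ := B.reward ρ)
  have h2 : (fun a : B.Arm => ∫ x, id x ∂(B.reward ρ a)) = fun a => ρ.expect a.1 :=
    funext fun a => integral_bornMeasure ρ (B.isHermitian a.1 a.2)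
  exact h2 ▸ h.measurable

/-- The σ-algebra on the actions is only known to make Born's rule measurable, hence every
$O\mapsto\mathrm{Tr}(\rho O)$. Each $\sigma_i$ is a real combination of pure states, by its spectral
decomposition, so this is enough. -/
theorem QuantumBandit.measurable_coord {d : ℕ} (B : QuantumBandit d) (σ : HermitianBasis d) :
    Measurable fun a : B.Arm => σ.coord a.1 := by
  refine measurable_pi_iff.2 fun i => ?_
  have h : ∀ a : B.Arm, σ.coord a.1 i =
      ∑ k, (σ.isHermitian i).eigenvalues k * (eigenstate (σ.isHermitian i) k).expect a.1 := by
    intro a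
    simp only [HermitianBasis.coord, trace_mul_eq_sum_eigenvalues (σ.isHermitian i),
      Complex.re_sum, Complex.re_ofReal_mul, QState.expect, eigenstate]
    refine Finset.sum_congr rfl fun k _ => ?_
    rw [Matrix.trace_mul_comm]
  simp only [h]
  exact Finset.measurable_sum _ fun k _ => (B.measurable_expect _).const_mul _

/-! ### A Gaussian mixture of exponential moments -/

/-- Completing the square in $g$: the tilted Gaussian is again Gaussian up to a factor, and that
factor is the growth of the self-normalised exponential in one round. -/
theorem exp_mul_gaussianPDFReal (s η : ℝ) {w : ℝ} (hw : 0 < w) (g : ℝ) :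
    Real.exp (g * η - g ^ 2 / 2) * gaussianPDFReal s w.toNNReal g =
      Real.exp ((2 * η * s + η ^ 2 * w - s ^ 2) / (2 * (1 + w)) - Real.log (1 + w) / 2) *
        gaussianPDFReal ((η * w + s) / (1 + w)) (w / (1 + w)).toNNReal g := by
  have h1 : 0 < 1 + w := by linarith
  have h2 : Real.exp (-(Real.log (1 + w) / 2)) = (√(1 + w))⁻¹ := by
    rw [Real.exp_neg, Real.exp_half, Real.exp_log h1]
  have h3 : √(2 * Real.pi * w) = √(1 + w) * √(2 * Real.pi * (w / (1 + w))) := by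
    rw [← Real.sqrt_mul h1.le]
    congr 1
    field_simp
  rw [gaussianPDFReal_def, gaussianPDFReal_def, Real.coe_toNNReal _ hw.le,
    Real.coe_toNNReal _ (by positivity)]
  simp only
  rw [h3, sub_eq_add_neg _ (Real.log (1 + w) / 2), Real.exp_add _ (-(Real.log (1 + w) / 2)), h2,
    mul_inv]
  have h4 : Real.exp (g * η - g ^ 2 / 2) * Real.exp (-(g - s) ^ 2 / (2 * w)) =
      Real.exp ((2 * η * s + η ^ 2 * w - s ^ 2) / (2 * (1 + w))) *
        Real.exp (-(g - (η * w + s) / (1 + w)) ^ 2 / (2 * (w / (1 + w)))) := by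
    rw [← Real.exp_add, ← Real.exp_add]
    congr 1
    field_simp
    ring
  linear_combination ((√(1 + w))⁻¹ * (√(2 * Real.pi * (w / (1 + w))))⁻¹) * h4

theorem lintegral_exp_mul_gaussianPDFReal (s η : ℝ) {w : ℝ} (hw : 0 < w) :
    ∫⁻ g, ENNReal.ofReal (Real.exp (g * η - g ^ 2 / 2) * gaussianPDFReal s w.toNNReal g) =
      ENNReal.ofReal (Real.exp ((2 * η * s + η ^ 2 * w - s ^ 2) / (2 * (1 + w))
        - Real.log (1 + w) / 2)) := by
  simp_rw [exp_mul_gaussianPDFReal s η hw, ENNReal.ofReal_mul (Real.exp_nonneg _)]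
  rw [lintegral_const_mul _ (measurable_gaussianPDFReal _ _).ennreal_ofReal,
    lintegral_gaussianPDFReal_eq_one _ (Real.toNNReal_pos.2 (by positivity)).ne', mul_one]

section Bounded

variable {ν : Measure ℝ} [IsProbabilityMeasure ν]

/-- Hoeffding's lemma; an interval of length 2 gives variance proxy $(2/2)^2=1$. -/
theorem lintegral_exp_sub_sq_le_one (hν : ∀ᵐ x ∂ν, x ∈ Set.Icc (-1 : ℝ) 1) (g : ℝ) :
    ∫⁻ x, ENNReal.ofReal (Real.exp (g * (x - ∫ y, y ∂ν) - g ^ 2 / 2)) ∂ν ≤ 1 := by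
  have h := hasSubgaussianMGF_of_mem_Icc (X := fun x : ℝ => x) aemeasurable_id hν
  have h1 := h.mgf_le g
  have hc : (((‖(1 : ℝ) - (-1)‖₊ / 2) ^ 2 : NNReal) : ℝ) = 1 := by
    norm_num
  rw [hc, one_mul, mgf] at h1
  have hi := h.integrable_exp_mul g
  have h2 : ∫ x, Real.exp (g * (x - ∫ y, y ∂ν) - g ^ 2 / 2) ∂ν ≤ 1 := by
    simp_rw [Real.exp_sub]
    rw [integral_div, div_le_one (Real.exp_pos _)]
    exact h1
  rw [← ofReal_integral_eq_lintegral_ofReal]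
  · exact ENNReal.ofReal_le_one.2 h2
  · simp_rw [Real.exp_sub]
    exact hi.div_const _
  · exact ae_of_all _ fun x => (Real.exp_pos _).le

theorem lintegral_exp_quadratic_le_one (hν : ∀ᵐ x ∂ν, x ∈ Set.Icc (-1 : ℝ) 1) (s : ℝ) {w : ℝ}
    (hw : 0 ≤ w) :
    ∫⁻ x, ENNReal.ofReal (Real.exp ((2 * (x - ∫ y, y ∂ν) * s + (x - ∫ y, y ∂ν) ^ 2 * w - s ^ 2)
      / (2 * (1 + w)) - Real.log (1 + w) / 2)) ∂ν ≤ 1 := by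
  -- For $w=0$ the mixing law degenerates to a point mass at $s$ without density, and Hoeffding's
  -- bound applies directly. For $w>0$, Tonelli lets the reward be integrated first.
  rcases hw.eq_or_lt with rfl | hw
  · refine le_trans (le_of_eq ?_) (lintegral_exp_sub_sq_le_one hν s)
    congr with x
    congr 2
    simp
    ring
  · simp_rw [← lintegral_exp_mul_gaussianPDFReal s _ hw]
    rw [lintegral_lintegral_swap]
    · have h1 : ∀ g, ∫⁻ x, ENNReal.ofReal (Real.exp (g * (x - ∫ y, y ∂ν) - g ^ 2 / 2) *
          gaussianPDFReal s w.toNNReal g) ∂ν ≤ ENNReal.ofReal (gaussianPDFReal s w.toNNReal g) := by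
        intro g
        simp_rw [ENNReal.ofReal_mul (Real.exp_nonneg _)]
        rw [lintegral_mul_const _ (by fun_prop)]
        exact mul_le_of_le_one_left' (lintegral_exp_sub_sq_le_one hν g)
      refine (lintegral_mono h1).trans_eq ?_
      exact lintegral_gaussianPDFReal_eq_one _ (Real.toNNReal_pos.2 hw).ne'
    · refine Measurable.aemeasurable (Measurable.ennreal_ofReal (Measurable.mul (by fun_prop) ?_))
      exact (measurable_gaussianPDFReal _ _).comp measurable_snd

end Bounded

/-! ### The law of the history, one round at a time -/

namespace QuantumBandit

variable {d : ℕ} (B : QuantumBandit d)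

theorem lintegral_historyLaw_succ (ρ : QState d) (π : B.Policy) {t : ℕ}
    {f : B.History (t + 1) → ENNReal} (hf : Measurable f) :
    ∫⁻ h, f h ∂(B.historyLaw ρ π (t + 1)) =
      ∫⁻ h, ∫⁻ a, ∫⁻ x, f (B.extend t (h, (a, x))) ∂(B.reward ρ a) ∂(π.kernel t h)
        ∂(B.historyLaw ρ π t) := by
  have hm := B.measurable_extend t
  rw [historyLaw, lintegral_map hf hm]
  change ∫⁻ p, (f ∘ B.extend t) p ∂_ = _
  rw [Measure.lintegral_compProd (hf.comp hm)]
  refine lintegral_congr fun h => ?_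
  exact Kernel.lintegral_compProd (π.kernel t) (Kernel.prodMkLeft _ (B.reward ρ)) h
    (f := fun p => f (B.extend t (h, p))) ((hf.comp hm).comp measurable_prodMk_left)

/-- A one-round drift bound. It is asked for only at almost every action of the policy, since the
LinUCB property says no more than that. -/
theorem integral_historyLaw_succ_le (ρ : QState d) (π : B.Policy) {t : ℕ}
    {f : B.History (t + 1) → ℝ} (hf : Integrable f (B.historyLaw ρ π (t + 1)))
    {u : B.History t → ℝ} (hu : Integrable u (B.historyLaw ρ π t))
    (h : ∀ h, ∀ᵐ a ∂(π.kernel t h), ∫ x, f (B.extend t (h, (a, x))) ∂(B.reward ρ a) ≤ u h) :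
    ∫ h, f h ∂(B.historyLaw ρ π (t + 1)) ≤ ∫ h, u h ∂(B.historyLaw ρ π t) := by
  have hm := B.measurable_extend t
  rw [historyLaw] at hf ⊢
  have hf' := hf.comp_measurable hm
  rw [integral_map hm.aemeasurable hf.aestronglyMeasurable]
  change ∫ x, (f ∘ B.extend t) x ∂_ ≤ _
  rw [Measure.integral_compProd hf']
  refine integral_mono_ae ?_ hu ?_
  · exact Integrable.integral_compProd (κ := Kernel.const Unit (B.historyLaw ρ π t))
      (η := Kernel.prodMkLeft Unit (π.kernel t ⊗ₖ Kernel.prodMkLeft _ (B.reward ρ))) (a := ()) hf'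
  · filter_upwards [((Measure.integrable_compProd_iff hf'.aestronglyMeasurable).1 hf').1]
      with g hg
    rw [ProbabilityTheory.integral_compProd hg]
    refine (integral_mono_ae hg.integral_compProd (integrable_const (u g)) (h g)).trans ?_
    simp

/-- The rewards of a history. -/
def rewards {t : ℕ} (h : B.History t) : Fin t → ℝ := fun s => (h s).2

theorem measurable_rewards (t : ℕ) : Measurable fun h : B.History t => B.rewards h :=
  measurable_pi_iff.2 fun s => measurable_snd.comp (measurable_pi_apply s)

theorem ae_abs_reward_le (hB : ∀ O ∈ B.actionSet,
    ‖Matrix.toEuclideanCLM (n := Fin d) (𝕜 := ℂ) O‖ ≤ 1) (ρ : QState d) (π : B.Policy) (t : ℕ) :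
    ∀ᵐ h ∂(B.historyLaw ρ π t), ∀ s, |(h s).2| ≤ 1 := by
  have hmeas : ∀ t, MeasurableSet {h : B.History t | ∀ s, |(h s).2| ≤ 1} := by
    intro t
    simp only [Set.ofPred_forall]
    refine MeasurableSet.iInter fun s => measurableSet_le ?_ measurable_const
    exact ((measurable_pi_apply s).comp (B.measurable_rewards t)).norm
  induction t with
  | zero => exact ae_of_all _ fun h s => s.elim0
  | succ t ih =>
    rw [historyLaw, ae_map_iff (B.measurable_extend t).aemeasurable (hmeas _)]
    have hm := (B.measurable_extend t) (hmeas (t + 1))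
    refine Measure.ae_compProd_of_ae_ae hm ?_
    filter_upwards [ih] with h hh
    refine Kernel.ae_compProd_of_ae_ae (measurable_prodMk_left hm) (ae_of_all _ fun a => ?_)
    filter_upwards [ae_bornMeasure_mem_Icc ρ (B.isHermitian a.1 a.2) (hB a.1 a.2)] with x hx s
    refine Fin.lastCases ?_ (fun j => ?_) s
    · simpa [extend] using abs_le.2 hx
    · simpa [extend] using hh j

/-! ### Actions and rewards of a history -/

/-- The coordinates of the actions of a history. -/
def actions (σ : HermitianBasis d) {t : ℕ} (h : B.History t) : Fin t → Fin (d ^ 2) → ℝ :=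
  fun s => σ.coord (h s).1.1

theorem measurable_actions (σ : HermitianBasis d) (t : ℕ) :
    Measurable fun h : B.History t => B.actions σ h :=
  measurable_pi_iff.2 fun s => (B.measurable_coord σ).comp (measurable_fst.comp (measurable_pi_apply s))

section

variable (σ : HermitianBasis d) {t : ℕ} (h : B.History t) (a : B.Arm) (x : ℝ)

theorem actions_extend_castSucc :
    (fun s : Fin t => B.actions σ (B.extend t (h, (a, x))) s.castSucc) = B.actions σ h := by
  funext s
  simp [actions, extend]

theorem rewards_extend_castSucc :
    (fun s : Fin t => B.rewards (B.extend t (h, (a, x))) s.castSucc) = B.rewards h := by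
  funext s
  simp [rewards, extend]

theorem actions_extend_last :
    B.actions σ (B.extend t (h, (a, x))) (Fin.last t) = σ.coord a.1 := by
  simp [actions, extend]

theorem rewards_extend_last : B.rewards (B.extend t (h, (a, x))) (Fin.last t) = x := by
  simp [rewards, extend]

theorem gram_actions_extend (lam : ℝ) :
    LinUCB.gram lam (B.actions σ (B.extend t (h, (a, x)))) =
      LinUCB.gram lam (B.actions σ h) + Matrix.vecMulVec (σ.coord a.1) (σ.coord a.1) := by
  rw [LinUCB.gram_succ, actions_extend_castSucc, actions_extend_last]

end

theorem measurable_selfNormalizedExp {lam : ℝ} (hlam : 0 < lam) (σ : HermitianBasis d)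
    (ρ : QState d) (t : ℕ) : Measurable fun h : B.History t =>
      LinUCB.selfNormalizedExp lam (σ.coord ρ.1) (B.actions σ h) (B.rewards h) := by
  have h := (LinUCB.continuous_selfNormalizedExp (D := d ^ 2) (t := t) hlam
    (σ.coord ρ.1)).measurable.comp ((B.measurable_actions σ t).prodMk (B.measurable_rewards t))
  exact h

/-- The exponential of the self-normalised noise has expectation at most one. -/
theorem lintegral_selfNormalizedExp_le_one (hB : ∀ O ∈ B.actionSet,
    ‖Matrix.toEuclideanCLM (n := Fin d) (𝕜 := ℂ) O‖ ≤ 1) {lam : ℝ} (hlam : 0 < lam)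
    (σ : HermitianBasis d) (ρ : QState d) (π : B.Policy) (t : ℕ) :
    ∫⁻ h, ENNReal.ofReal (LinUCB.selfNormalizedExp lam (σ.coord ρ.1) (B.actions σ h)
      (B.rewards h)) ∂(B.historyLaw ρ π t) ≤ 1 := by
  induction t with
  | zero =>
    have h1 : ∀ h : B.History 0, LinUCB.selfNormalizedExp lam (σ.coord ρ.1) (B.actions σ h)
        (B.rewards h) = 1 := by
      intro h
      simp [LinUCB.selfNormalizedExp, LinUCB.noise, LinUCB.gram]
    simp [h1]
  | succ t ih =>
    rw [B.lintegral_historyLaw_succ ρ π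
      (B.measurable_selfNormalizedExp hlam σ ρ (t + 1)).ennreal_ofReal]
    refine le_trans (lintegral_mono fun h => ?_) ih
    refine (lintegral_mono fun a => ?_).trans
      (lintegral_const (μ := π.kernel t h) _ |>.trans (by rw [measure_univ, mul_one])).le
    have hV := LinUCB.posDef_gram hlam (B.actions σ h)
    -- The noise of the new round is thus the centred reward, as the subgaussian bound requires.
    have hmean : σ.coord a.1 ⬝ᵥ σ.coord ρ.1 = ∫ y, y ∂(B.reward ρ a) := by
      rw [σ.coord_dotProduct_state ρ (B.isHermitian a.1 a.2)]
      exact (integral_bornMeasure ρ (B.isHermitian a.1 a.2)).symm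
    have hstep : ∀ x, LinUCB.selfNormalizedExp lam (σ.coord ρ.1)
        (B.actions σ (B.extend t (h, (a, x)))) (B.rewards (B.extend t (h, (a, x)))) = _ := fun x =>
      LinUCB.selfNormalizedExp_succ hlam (σ.coord ρ.1)
      (B.actions σ (B.extend t (h, (a, x)))) (B.rewards (B.extend t (h, (a, x))))
      (B.actions_extend_last σ h a x)
      (congrArg (LinUCB.gram lam) (B.actions_extend_castSucc σ h a x).symm)
      (congrArg₂ (LinUCB.noise (σ.coord ρ.1)) (B.actions_extend_castSucc σ h a x).symm
        (B.rewards_extend_castSucc h a x).symm)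
      (η := x - ∫ y, y ∂(B.reward ρ a)) (by rw [rewards_extend_last, hmean])
    simp only [actions_extend_castSucc, rewards_extend_castSucc] at hstep
    rw [lintegral_congr fun x => (congrArg ENNReal.ofReal (hstep x)).trans
      (ENNReal.ofReal_mul (Real.exp_pos _).le),
      lintegral_const_mul _ (by fun_prop)]
    exact mul_le_of_le_one_right' (lintegral_exp_quadratic_le_one (ν := B.reward ρ a)
      (ae_bornMeasure_mem_Icc ρ (B.isHermitian a.1 a.2) (hB a.1 a.2)) _
      (hV.inv.posSemidef.quad_nonneg _))

end QuantumBandit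

/-! ### The regret of LinUCB -/

/-- Weighted arithmetic-geometric mean together with $\min(1,q)^2\le 2\log(1+q^2)$. Being linear in
the logarithm, it replaces Cauchy–Schwarz over the rounds and can be used one round at a time. -/
theorem min_one_le_add_mul_log {c q : ℝ} (hc : 0 < c) (hq : 0 ≤ q) :
    min 1 q ≤ 1 / (2 * c) + c * Real.log (1 + q ^ 2) := by
  have h1 : min 1 q ≤ 1 / (2 * c) + c / 2 * (min 1 q) ^ 2 := by
    have h : 0 ≤ (1 - c * min 1 q) ^ 2 / (2 * c) := by positivity
    have h' : (1 - c * min 1 q) ^ 2 / (2 * c) =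
      1 / (2 * c) + c / 2 * (min 1 q) ^ 2 - min 1 q := by field_simp; ring
    linarith
  have h2 : (min 1 q) ^ 2 ≤ 2 * Real.log (1 + q ^ 2) := by
    have h := Real.one_sub_inv_le_log_of_pos (show 0 < 1 + q ^ 2 by positivity)
    have h3 : (min 1 q) ^ 2 ≤ 2 * (1 - (1 + q ^ 2)⁻¹) := by
      have h4 : 2 * (1 - (1 + q ^ 2)⁻¹) = 2 * q ^ 2 / (1 + q ^ 2) := by field_simp; ring
      rw [h4, le_div_iff₀ (by positivity)]
      rcases le_total 1 q with h5 | h5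
      · rw [min_eq_left h5]; nlinarith
      · rw [min_eq_right h5]; nlinarith [mul_nonneg hq hq, mul_nonneg (sub_nonneg.2 h5) hq]
    linarith
  have h6 := mul_le_mul_of_nonneg_left h2 hc.le
  linarith

namespace QuantumBandit

variable {d : ℕ} (B : QuantumBandit d)

instance instNonemptyArm : Nonempty B.Arm := B.nonempty.to_subtype

/-- The best expected reward. -/
def bestReward (ρ : QState d) : ℝ := ⨆ O : B.Arm, ρ.expect O.1

/-- The histories after which the self-normalised noise is exceptionally large. -/
def badHistories (lam δ : ℝ) (σ : HermitianBasis d) (ρ : QState d) (t : ℕ) : Set (B.History t) :=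
  {h | 1 / δ < LinUCB.selfNormalizedExp lam (σ.coord ρ.1) (B.actions σ h) (B.rewards h)}

theorem measurableSet_badHistories {lam : ℝ} (hlam : 0 < lam) (δ : ℝ) (σ : HermitianBasis d)
    (ρ : QState d) (t : ℕ) : MeasurableSet (B.badHistories lam δ σ ρ t) :=
  measurableSet_lt measurable_const (B.measurable_selfNormalizedExp hlam σ ρ t)

variable {B}

/-- Markov's inequality. A bound at each fixed time suffices, because expected regret adds up over
rounds; no maximal inequality is needed. -/
theorem measureReal_badHistories_le
    (hB : ∀ O ∈ B.actionSet, ‖Matrix.toEuclideanCLM (n := Fin d) (𝕜 := ℂ) O‖ ≤ 1) {lam : ℝ} (hlam : 0 < lam) {δ : ℝ} (hδ : 0 < δ)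
    (σ : HermitianBasis d) (ρ : QState d) (π : B.Policy) (t : ℕ) :
    (B.historyLaw ρ π t).real (B.badHistories lam δ σ ρ t) ≤ δ := by
  have h := (mul_meas_ge_le_lintegral
    (B.measurable_selfNormalizedExp hlam σ ρ t).ennreal_ofReal (ENNReal.ofReal (1 / δ))).trans
    (B.lintegral_selfNormalizedExp_le_one hB hlam σ ρ π t)
  have h2 : ENNReal.ofReal (1 / δ) * (B.historyLaw ρ π t) (B.badHistories lam δ σ ρ t) ≤ 1 :=
    (mul_le_mul_right (measure_mono fun h hh => ENNReal.ofReal_le_ofReal (le_of_lt hh)) _).trans h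
  have h3 := ENNReal.toReal_mono ENNReal.one_ne_top h2
  rw [ENNReal.toReal_mul, ENNReal.toReal_ofReal (by positivity), ENNReal.toReal_one] at h3
  rw [measureReal_def]
  rwa [one_div, inv_mul_le_iff₀ hδ, mul_one] at h3

theorem coord_dotProduct_self_le
    (hB : ∀ O ∈ B.actionSet, ‖Matrix.toEuclideanCLM (n := Fin d) (𝕜 := ℂ) O‖ ≤ 1)
    (σ : HermitianBasis d) (a : B.Arm) : σ.coord a.1 ⬝ᵥ σ.coord a.1 ≤ √(d : ℝ) ^ 2 := by
  rw [Real.sq_sqrt d.cast_nonneg,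
    σ.coord_dotProduct_coord (B.isHermitian a.1 a.2) (B.isHermitian a.1 a.2)]
  exact trace_sq_le (B.isHermitian a.1 a.2) (hB a.1 a.2)

theorem mem_confidenceSet_of_notMem_badHistories
    (hB : ∀ O ∈ B.actionSet, ‖Matrix.toEuclideanCLM (n := Fin d) (𝕜 := ℂ) O‖ ≤ 1)
    (hd : 0 < d) {lam : ℝ} (hlam : 0 < lam) {δ : ℝ} (hδ : 0 < δ) (σ : HermitianBasis d)
    (ρ : QState d) {t n : ℕ} (htn : t ≤ n) {h : B.History t}
    (hh : h ∉ B.badHistories lam δ σ ρ t) :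
    σ.coord ρ.1 ∈ LinUCB.confidenceSet n lam d (√(d : ℝ)) δ (B.actions σ h) (B.rewards h) := by
  by_contra hcon
  refine hh (LinUCB.lt_selfNormalizedExp hlam (pow_pos hd 2) htn hδ (B.actions σ h)
    (fun s => coord_dotProduct_self_le hB σ (h s).1) (B.rewards h) (σ.coord ρ.1) ?_ hcon)
  rw [σ.coord_dotProduct_coord ρ.2.1.isHermitian ρ.2.1.isHermitian]
  calc √((ρ.1 * ρ.1).trace.re) ≤ √1 := Real.sqrt_le_sqrt ρ.trace_sq_le_one
    _ = 1 := Real.sqrt_one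
    _ ≤ d := by exact_mod_cast hd

theorem bestReward_le_one
    (hB : ∀ O ∈ B.actionSet, ‖Matrix.toEuclideanCLM (n := Fin d) (𝕜 := ℂ) O‖ ≤ 1)
    (ρ : QState d) : B.bestReward ρ ≤ 1 :=
  ciSup_le fun a => (abs_le.1 (abs_expect_le ρ (B.isHermitian a.1 a.2) (hB a.1 a.2))).2

/-- Optimism: if the true parameter lies in the confidence set, then the regret of the played
action is at most twice the width of the confidence set in its direction. -/
theorem IsLinUCB.bestReward_sub_le {lam : ℝ} (hlam : 0 < lam) {σ : HermitianBasis d} {n : ℕ}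
    {m L δ : ℝ} {π : B.Policy} (hπ : B.IsLinUCB σ n lam m L δ π) (ρ : QState d) {t : ℕ}
    (htn : t < n) {h : B.History t}
    (hh : σ.coord ρ.1 ∈ LinUCB.confidenceSet n lam m L δ (B.actions σ h) (B.rewards h)) :
    ∀ᵐ a ∂(π.kernel t h), B.bestReward ρ - ρ.expect a.1 ≤
      2 * LinUCB.radius (d ^ 2) n lam m L δ *
        (LinUCB.gram lam (B.actions σ h))⁻¹.qnorm (σ.coord a.1) := by
  filter_upwards [hπ t htn h] with a ha
  obtain ⟨θ', hθ', hmax⟩ := ha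
  have hV := LinUCB.posDef_gram hlam (B.actions σ h)
  set V := LinUCB.gram lam (B.actions σ h)
  set e := LinUCB.estimator lam (B.actions σ h) (B.rewards h)
  set β := LinUCB.radius (d ^ 2) n lam m L δ
  set q := V⁻¹.qnorm (σ.coord a.1)
  have hq : 0 ≤ q := Matrix.qnorm_nonneg _ _
  have h1 : (θ' - e) ⬝ᵥ σ.coord a.1 ≤ β * q :=
    (hV.dotProduct_le_qnorm _ _).trans (mul_le_mul_of_nonneg_right hθ' hq)
  have h2 : (e - σ.coord ρ.1) ⬝ᵥ σ.coord a.1 ≤ β * q := by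
    refine (hV.dotProduct_le_qnorm _ _).trans (mul_le_mul_of_nonneg_right ?_ hq)
    rw [← neg_sub, Matrix.qnorm_neg]
    exact hh
  have h3 : B.bestReward ρ ≤ θ' ⬝ᵥ σ.coord a.1 := by
    refine ciSup_le fun b => ?_
    rw [← σ.coord_dotProduct_state ρ (B.isHermitian b.1 b.2), dotProduct_comm]
    exact hmax b _ hh
  have h4 : ρ.expect a.1 = σ.coord ρ.1 ⬝ᵥ σ.coord a.1 := by
    rw [← σ.coord_dotProduct_state ρ (B.isHermitian a.1 a.2), dotProduct_comm]
  rw [sub_dotProduct] at h1 h2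
  linarith

/-- The regret of one round, bounded by the growth of `log det V_t`. -/
theorem IsLinUCB.bestReward_sub_le_log
    (hB : ∀ O ∈ B.actionSet, ‖Matrix.toEuclideanCLM (n := Fin d) (𝕜 := ℂ) O‖ ≤ 1)
    (hd : 0 < d) {lam : ℝ} (hlam : 0 < lam) {δ : ℝ} (hδ : 0 < δ) {σ : HermitianBasis d} {n : ℕ}
    {π : B.Policy} (hπ : B.IsLinUCB σ n lam d (√(d : ℝ)) δ π) (ρ : QState d) {t : ℕ}
    (htn : t < n) {c β : ℝ} (hc : 0 < c) (hβ1 : 1 ≤ β)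
    (hβ : LinUCB.radius (d ^ 2) n lam d (√(d : ℝ)) δ ≤ β) (h : B.History t) :
    ∀ᵐ a ∂(π.kernel t h), B.bestReward ρ - ρ.expect a.1 ≤
      2 * (B.badHistories lam δ σ ρ t).indicator 1 h + β / c + 2 * β * c *
        Real.log (1 + σ.coord a.1 ⬝ᵥ ((LinUCB.gram lam (B.actions σ h))⁻¹ *ᵥ σ.coord a.1)) := by
  have hV := LinUCB.posDef_gram hlam (B.actions σ h)
  have htwo : ∀ a : B.Arm, B.bestReward ρ - ρ.expect a.1 ≤ 2 := fun a => by
    have := (abs_le.1 (abs_expect_le ρ (B.isHermitian a.1 a.2) (hB a.1 a.2))).1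
    have := bestReward_le_one hB ρ
    linarith
  by_cases hh : h ∈ B.badHistories lam δ σ ρ t
  · refine ae_of_all _ fun a => (htwo a).trans ?_
    have h0 : 0 ≤ Real.log (1 + σ.coord a.1 ⬝ᵥ
        ((LinUCB.gram lam (B.actions σ h))⁻¹ *ᵥ σ.coord a.1)) :=
      Real.log_nonneg (le_add_of_nonneg_right (hV.inv.posSemidef.quad_nonneg _))
    rw [Set.indicator_of_mem hh, Pi.one_apply, mul_one, add_assoc]
    exact le_add_of_nonneg_right (by positivity)
  · filter_upwards [hπ.bestReward_sub_le hlam ρ htn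
      (mem_confidenceSet_of_notMem_badHistories hB hd hlam hδ σ ρ htn.le hh)] with a ha
    rw [Set.indicator_of_notMem hh, mul_zero, zero_add, ← hV.inv.posSemidef.qnorm_sq]
    have hq := Matrix.qnorm_nonneg (LinUCB.gram lam (B.actions σ h))⁻¹ (σ.coord a.1)
    set q := (LinUCB.gram lam (B.actions σ h))⁻¹.qnorm (σ.coord a.1)
    -- Truncating at 1 costs nothing, as the regret of a round is at most $2\le 2\beta$.
    have h1 : B.bestReward ρ - ρ.expect a.1 ≤ 2 * β * min 1 q := by
      rcases le_total 1 q with h5 | h5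
      · rw [min_eq_left h5]
        linarith [htwo a]
      · rw [min_eq_right h5]
        refine ha.trans ?_
        gcongr
    have h2 := mul_le_mul_of_nonneg_left (min_one_le_add_mul_log hc hq)
      (show 0 ≤ 2 * β by linarith)
    have h3 : 2 * β * (1 / (2 * c) + c * Real.log (1 + q ^ 2)) =
        β / c + 2 * β * c * Real.log (1 + q ^ 2) := by
      field_simp
    linarith

/-! ### The compensated regret and its drift. -/

variable (B) in
/-- The cumulative regret along a history, compensated by a multiple of `log det V_t`. -/
def compensatedRegret (K lam : ℝ) (σ : HermitianBasis d) (ρ : QState d) {t : ℕ}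
    (h : B.History t) : ℝ :=
  ∑ s, (B.bestReward ρ - B.rewards h s) - K * Real.log (LinUCB.gram lam (B.actions σ h)).det

theorem measurable_log_det {lam : ℝ} (hlam : 0 < lam) (σ : HermitianBasis d) (t : ℕ) :
    Measurable fun h : B.History t => Real.log (LinUCB.gram lam (B.actions σ h)).det := by
  have h := (LinUCB.continuous_log_det_gram (D := d ^ 2) (t := t) hlam).measurable.comp
    (B.measurable_actions σ t)
  exact h

theorem log_det_gram_actions_le
    (hB : ∀ O ∈ B.actionSet, ‖Matrix.toEuclideanCLM (n := Fin d) (𝕜 := ℂ) O‖ ≤ 1)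
    (hd : 0 < d) {lam : ℝ} (hlam : 0 < lam) (σ : HermitianBasis d) {t n : ℕ} (htn : t ≤ n)
    (h : B.History t) :
    Real.log (LinUCB.gram lam (B.actions σ h)).det ≤ (d ^ 2 : ℕ) * Real.log lam +
      (d ^ 2 : ℕ) * Real.log (((d ^ 2 : ℕ) * lam + n * √(d : ℝ) ^ 2) / ((d ^ 2 : ℕ) * lam)) := by
  have := LinUCB.log_det_gram_le hlam (pow_pos hd 2) htn (B.actions σ h)
    (fun s => coord_dotProduct_self_le hB σ (h s).1)
  linarith

theorem integrable_log_det
    (hB : ∀ O ∈ B.actionSet, ‖Matrix.toEuclideanCLM (n := Fin d) (𝕜 := ℂ) O‖ ≤ 1)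
    (hd : 0 < d) {lam : ℝ} (hlam : 0 < lam) (σ : HermitianBasis d) (ρ : QState d) (π : B.Policy)
    (t : ℕ) : Integrable (fun h : B.History t => Real.log (LinUCB.gram lam (B.actions σ h)).det)
      (B.historyLaw ρ π t) :=
  Integrable.of_mem_Icc _ _ (measurable_log_det hlam σ t).aemeasurable (ae_of_all _ fun h =>
    ⟨LinUCB.le_log_det_gram hlam _, log_det_gram_actions_le hB hd hlam σ le_rfl h⟩)

theorem integrable_reward
    (hB : ∀ O ∈ B.actionSet, ‖Matrix.toEuclideanCLM (n := Fin d) (𝕜 := ℂ) O‖ ≤ 1)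
    (ρ : QState d) (π : B.Policy) (t : ℕ) (s : Fin t) :
    Integrable (fun h : B.History t => B.rewards h s) (B.historyLaw ρ π t) := by
  refine Integrable.of_mem_Icc (-1) 1
    ((measurable_pi_apply s).comp (B.measurable_rewards t)).aemeasurable ?_
  filter_upwards [B.ae_abs_reward_le hB ρ π t] with h hh
  exact abs_le.1 (hh s)

theorem integrable_compensatedRegret
    (hB : ∀ O ∈ B.actionSet, ‖Matrix.toEuclideanCLM (n := Fin d) (𝕜 := ℂ) O‖ ≤ 1)
    (hd : 0 < d) (K : ℝ) {lam : ℝ} (hlam : 0 < lam) (σ : HermitianBasis d) (ρ : QState d)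
    (π : B.Policy) (t : ℕ) :
    Integrable (fun h : B.History t => B.compensatedRegret K lam σ ρ h) (B.historyLaw ρ π t) :=
  (integrable_finsetSum _ fun s _ =>
    (integrable_const _).sub (integrable_reward hB ρ π t s)).sub
    ((integrable_log_det hB hd hlam σ ρ π t).const_mul K)

theorem compensatedRegret_extend (K : ℝ) {lam : ℝ} (hlam : 0 < lam) (σ : HermitianBasis d)
    (ρ : QState d) {t : ℕ} (h : B.History t) (a : B.Arm) (x : ℝ) :
    B.compensatedRegret K lam σ ρ (B.extend t (h, (a, x))) =
      B.compensatedRegret K lam σ ρ h + (B.bestReward ρ - x) - K *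
        Real.log (1 + σ.coord a.1 ⬝ᵥ ((LinUCB.gram lam (B.actions σ h))⁻¹ *ᵥ σ.coord a.1)) := by
  have hV := LinUCB.posDef_gram hlam (B.actions σ h)
  have hw := hV.inv.posSemidef.quad_nonneg (σ.coord a.1)
  rw [compensatedRegret, compensatedRegret, gram_actions_extend, hV.det_add_vecMulVec_self,
    Real.log_mul hV.det_pos.ne' (by positivity), Fin.sum_univ_castSucc, rewards_extend_last]
  have h1 : ∀ s : Fin t, B.rewards (B.extend t (h, (a, x))) s.castSucc = B.rewards h s :=
    congrFun (B.rewards_extend_castSucc h a x)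
  simp only [h1]
  ring

/-- With the multiplier $2\beta c$ the increment of $\log\det V$ cancels the logarithm in the
one-round bound, leaving $\beta/c$ and twice the probability of a bad history. The last term is the
initial value, from $V_0=\lambda I$. -/
theorem IsLinUCB.integral_compensatedRegret_le
    (hB : ∀ O ∈ B.actionSet, ‖Matrix.toEuclideanCLM (n := Fin d) (𝕜 := ℂ) O‖ ≤ 1)
    (hd : 0 < d) {lam : ℝ} (hlam : 0 < lam) {δ : ℝ} (hδ : 0 < δ) {σ : HermitianBasis d} {n : ℕ}
    {π : B.Policy} (hπ : B.IsLinUCB σ n lam d (√(d : ℝ)) δ π) (ρ : QState d)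
    {c β : ℝ} (hc : 0 < c) (hβ1 : 1 ≤ β)
    (hβ : LinUCB.radius (d ^ 2) n lam d (√(d : ℝ)) δ ≤ β) {t : ℕ} (htn : t ≤ n) :
    ∫ h, B.compensatedRegret (2 * β * c) lam σ ρ h ∂(B.historyLaw ρ π t) ≤
      t * (2 * δ + β / c) - 2 * β * c * ((d ^ 2 : ℕ) * Real.log lam) := by
  induction t with
  | zero =>
    have h0 : ∀ h : B.History 0, B.compensatedRegret (2 * β * c) lam σ ρ h =
        -(2 * β * c * ((d ^ 2 : ℕ) * Real.log lam)) := by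
      intro h
      simp [compensatedRegret, LinUCB.gram]
    simp [h0]
  | succ t ih =>
    have hF := integrable_compensatedRegret hB hd (2 * β * c) hlam σ ρ π t
    have hbm := B.measurableSet_badHistories hlam δ σ ρ t
    have hI : Integrable ((B.badHistories lam δ σ ρ t).indicator (1 : B.History t → ℝ))
        (B.historyLaw ρ π t) := (integrable_const (1 : ℝ)).indicator hbm
    have hstep := B.integral_historyLaw_succ_le ρ π
      (integrable_compensatedRegret hB hd (2 * β * c) hlam σ ρ π (t + 1))
      (u := fun h => B.compensatedRegret (2 * β * c) lam σ ρ h +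
        (2 * (B.badHistories lam δ σ ρ t).indicator 1 h + β / c))
      (hF.add ((hI.const_mul 2).add (integrable_const _))) (fun h => by
        filter_upwards [hπ.bestReward_sub_le_log hB hd hlam hδ ρ (Nat.lt_of_succ_le htn) hc hβ1
          hβ h] with a ha
        have hx : Integrable (fun x : ℝ => x) (B.reward ρ a) :=
          Integrable.of_mem_Icc (-1) 1 aemeasurable_id
            (ae_bornMeasure_mem_Icc ρ (B.isHermitian a.1 a.2) (hB a.1 a.2))
        have hmean : ∫ x, x ∂(B.reward ρ a) = ρ.expect a.1 :=
          integral_bornMeasure ρ (B.isHermitian a.1 a.2)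
        have hlin : ∀ p q : ℝ, ∫ x, (p + (B.bestReward ρ - x) - q) ∂(B.reward ρ a) =
            p + (B.bestReward ρ - ρ.expect a.1) - q := by
          intro p q
          have h1 : (fun x : ℝ => p + (B.bestReward ρ - x) - q) =
              fun x => (p + B.bestReward ρ - q) - x := by ext; ring
          rw [h1, integral_sub (integrable_const _) hx, hmean, integral_const, probReal_univ,
            one_smul]
          ring
        simp only [compensatedRegret_extend (2 * β * c) hlam, hlin]
        linarith)
    refine hstep.trans ?_
    have hI2 : Integrable (fun h => 2 * (B.badHistories lam δ σ ρ t).indicator (1 : B.History t → ℝ) h +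
        β / c) (B.historyLaw ρ π t) := (hI.const_mul 2).add (integrable_const _)
    rw [integral_add hF hI2, integral_add (hI.const_mul 2) (integrable_const _),
      integral_const_mul, integral_indicator_one hbm, integral_const, probReal_univ, one_smul]
    have h1 := measureReal_badHistories_le hB hlam hδ σ ρ π t
    have h2 := ih (Nat.le_of_succ_le htn)
    push_cast at h2 ⊢
    linarith

theorem IsLinUCB.regret_le
    (hB : ∀ O ∈ B.actionSet, ‖Matrix.toEuclideanCLM (n := Fin d) (𝕜 := ℂ) O‖ ≤ 1)
    (hd : 0 < d) {lam : ℝ} (hlam : 0 < lam) {δ : ℝ} (hδ : 0 < δ) {σ : HermitianBasis d} {n : ℕ}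
    {π : B.Policy} (hπ : B.IsLinUCB σ n lam d (√(d : ℝ)) δ π) (ρ : QState d)
    {c β : ℝ} (hc : 0 < c) (hβ1 : 1 ≤ β)
    (hβ : LinUCB.radius (d ^ 2) n lam d (√(d : ℝ)) δ ≤ β) :
    B.regret ρ π n ≤ n * (2 * δ + β / c) + 2 * β * c *
      ((d ^ 2 : ℕ) * Real.log (((d ^ 2 : ℕ) * lam + n * √(d : ℝ) ^ 2) / ((d ^ 2 : ℕ) * lam))) := by
  have h1 := hπ.integral_compensatedRegret_le hB hd hlam hδ ρ hc hβ1 hβ le_rfl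
  have hlog := integrable_log_det hB hd hlam σ ρ π n
  have hr := fun s : Fin n => integrable_reward hB ρ π n s
  have h2 : ∫ h, B.compensatedRegret (2 * β * c) lam σ ρ h ∂(B.historyLaw ρ π n) =
      B.regret ρ π n - 2 * β * c *
        ∫ h, Real.log (LinUCB.gram lam (B.actions σ h)).det ∂(B.historyLaw ρ π n) := by
    have hr' : ∀ s ∈ Finset.univ, Integrable (fun h : B.History n =>
        B.bestReward ρ - B.rewards h s) (B.historyLaw ρ π n) :=
      fun s _ => (integrable_const _).sub (hr s)
    unfold compensatedRegret
    rw [integral_sub (integrable_finsetSum _ hr') (hlog.const_mul _), integral_const_mul,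
      integral_finsetSum _ hr', regret]
    congr 1
    refine Finset.sum_congr rfl fun s _ => ?_
    rw [integral_sub (integrable_const _) (hr s), integral_const, probReal_univ, one_smul]
    rfl
  have h3 : ∫ h, Real.log (LinUCB.gram lam (B.actions σ h)).det ∂(B.historyLaw ρ π n) ≤
      (d ^ 2 : ℕ) * Real.log lam + (d ^ 2 : ℕ) *
        Real.log (((d ^ 2 : ℕ) * lam + n * √(d : ℝ) ^ 2) / ((d ^ 2 : ℕ) * lam)) := by
    refine (integral_mono hlog (integrable_const _)
      fun h => log_det_gram_actions_le hB hd hlam σ le_rfl h).trans ?_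
    simp
  have h4 := mul_le_mul_of_nonneg_left h3 (show 0 ≤ 2 * β * c by positivity)
  linarith

end QuantumBandit

namespace QuantumBandit

variable {d : ℕ} {B : QuantumBandit d}

/-! ### Existence of LinUCB policies -/

theorem IsDiscrete.isCompactBorel (h : B.IsDiscrete) : B.IsCompactBorel := by
  refine ⟨h.1.isCompact, ?_⟩
  have : Finite B.actionSet := h.1
  rw [h.2, borel_eq_top_of_discrete]

/-- The joint maximisation is iterated: over the ellipsoid it gives `ucb`, over the actions a
measurable selection. The policy is deterministic. -/
theorem IsCompactBorel.exists_isLinUCB (h : B.IsCompactBorel) (σ : HermitianBasis d) (n : ℕ)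
    {lam : ℝ} (hlam : 0 < lam) {m : ℝ} (hm : 0 ≤ m) (L δ : ℝ) :
    ∃ π : B.Policy, B.IsLinUCB σ n lam m L δ π := by
  have hcomp : CompactSpace B.Arm := isCompact_iff_compactSpace.1 h.1
  have hborel : BorelSpace B.Arm := ⟨h.2⟩
  have : TopologicalSpace.MetrizableSpace (Matrix (Fin d) (Fin d) ℂ) :=
    inferInstanceAs (TopologicalSpace.MetrizableSpace (Fin d → Fin d → ℂ))
  have hsel : ∀ t, ∃ s : B.History t → B.Arm, Measurable s ∧ ∀ g (k : B.Arm),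
      LinUCB.ucb n lam m L δ (B.actions σ g) (B.rewards g) (σ.coord k.1) ≤
        LinUCB.ucb n lam m L δ (B.actions σ g) (B.rewards g) (σ.coord (s g).1) := by
    intro t
    have hcont := LinUCB.continuous_ucb (D := d ^ 2) (t := t) hlam n m L δ
    refine exists_measurable_isMax (fun k => ?_) (fun g => ?_)
    · have h1 := hcont.measurable.comp (((B.measurable_actions σ t).prodMk
        (B.measurable_rewards t)).prodMk (measurable_const (a := σ.coord k.1)))
      exact h1
    · have h1 := hcont.comp (Continuous.prodMk
        (continuous_const (y := (B.actions σ g, B.rewards g)))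
        (σ.continuous_coord.comp continuous_subtype_val : Continuous fun a : B.Arm => σ.coord a.1))
      exact h1
  choose s hs hmax using hsel
  refine ⟨⟨fun t => Kernel.deterministic (s t) (hs t), fun t => inferInstance⟩, ?_⟩
  intro t _ g
  have hae : ∀ᵐ a ∂(Measure.dirac (s t g)), a = s t g := by
    have : MeasurableSingletonClass B.Arm := inferInstance
    rw [ae_dirac_eq]
    exact Filter.mem_pure.2 rfl
  change ∀ᵐ a ∂(Kernel.deterministic (s t) (hs t) g), _
  rw [Kernel.deterministic_apply]
  filter_upwards [hae] with a ha
  subst ha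
  obtain ⟨θ', hθ', heq⟩ := LinUCB.exists_dotProduct_eq_ucb hlam n (L := L) (δ := δ) hm
    (B.actions σ g) (B.rewards g) (σ.coord (s t g).1)
  refine ⟨θ', hθ', fun b θ hθ => ?_⟩
  rw [heq]
  exact (LinUCB.dotProduct_le_ucb hlam n _ _ _ θ hθ).trans (hmax t g b)

end QuantumBandit

/-! ### The rate -/

theorem one_half_lt_log {n : ℕ} (hn : 2 ≤ n) : 1 / 2 < Real.log n := by
  have h : Real.log 2 ≤ Real.log n := Real.log_le_log (by norm_num) (by exact_mod_cast hn)
  linarith [Real.log_two_gt_d9]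

/-- The constant bounding the logarithmic volume ratio of the confidence ellipsoids. -/
def volumeConst (lam : ℝ) : ℝ := 1 + 2 * Real.log (1 + 1 / lam)

theorem one_le_volumeConst {lam : ℝ} (hlam : 0 < lam) : 1 ≤ volumeConst lam := by
  have : 0 ≤ Real.log (1 + 1 / lam) := Real.log_nonneg (le_add_of_nonneg_right (by positivity))
  rw [volumeConst]
  linarith

/-- The ratio is $1+n/(d\lambda)\le n(1+1/\lambda)$. Since $\log n>1/2$, the constant
$\log(1+1/\lambda)$ is at most $2\log(1+1/\lambda)\log n$, whence the 2 in `volumeConst`. -/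
theorem log_volume_le {lam : ℝ} (hlam : 0 < lam) {d n : ℕ} (hd : 0 < d) (hn : 2 ≤ n) :
    Real.log (((d ^ 2 : ℕ) * lam + n * √(d : ℝ) ^ 2) / ((d ^ 2 : ℕ) * lam)) ≤
      volumeConst lam * Real.log n := by
  have hd' : (1 : ℝ) ≤ d := by exact_mod_cast hd
  have hn' : (2 : ℝ) ≤ n := by exact_mod_cast hn
  have hl := one_half_lt_log hn
  have h0 : 0 ≤ Real.log (1 + 1 / lam) := Real.log_nonneg (le_add_of_nonneg_right (by positivity))
  have h1 : ((d ^ 2 : ℕ) * lam + n * √(d : ℝ) ^ 2) / ((d ^ 2 : ℕ) * lam) ≤ n * (1 + 1 / lam) := by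
    rw [Real.sq_sqrt d.cast_nonneg]
    push_cast
    have h2 : ((d : ℝ) ^ 2 * lam + n * d) / (d ^ 2 * lam) = 1 + n / (d * lam) := by
      field_simp
    have h3 : (n : ℝ) / (d * lam) ≤ n / lam := by
      gcongr
      exact le_mul_of_one_le_left hlam.le hd'
    rw [h2, mul_add, mul_one, mul_one_div]
    linarith
  refine (Real.log_le_log (by positivity) h1).trans ?_
  rw [Real.log_mul (by positivity) (by positivity), volumeConst]
  nlinarith

theorem radius_le {lam : ℝ} (hlam : 0 < lam) {d n : ℕ} (hd : 0 < d) (hn : 2 ≤ n) :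
    LinUCB.radius (d ^ 2) n lam d (√(d : ℝ)) (1 / (n : ℝ)) ≤
      (2 * √lam + √(2 + volumeConst lam)) * (d * √(Real.log n)) := by
  have hd' : (1 : ℝ) ≤ d := by exact_mod_cast hd
  have hl := one_half_lt_log hn
  have hl0 : 0 ≤ Real.log n := by linarith
  have hsq : 1 / 2 ≤ √(Real.log n) := Real.le_sqrt_of_sq_le (by linarith)
  have hv := one_le_volumeConst hlam
  rw [LinUCB.radius, add_mul, one_div_one_div]
  have h1 : √(2 * Real.log n + (d ^ 2 : ℕ) *
      Real.log (((d ^ 2 : ℕ) * lam + n * √(d : ℝ) ^ 2) / ((d ^ 2 : ℕ) * lam))) ≤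
      √(2 + volumeConst lam) * (d * √(Real.log n)) := by
    have h2 : √(2 + volumeConst lam) * (d * √(Real.log n)) =
        √((2 + volumeConst lam) * ((d : ℝ) ^ 2 * Real.log n)) := by
      rw [Real.sqrt_mul (by linarith), Real.sqrt_mul (by positivity),
        Real.sqrt_sq d.cast_nonneg]
    rw [h2]
    refine Real.sqrt_le_sqrt ?_
    have h3 := mul_le_mul_of_nonneg_left (log_volume_le hlam hd hn)
      (show (0 : ℝ) ≤ ((d ^ 2 : ℕ) : ℝ) by positivity)
    push_cast at h3 ⊢
    have h4 : Real.log n ≤ (d : ℝ) ^ 2 * Real.log n :=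
      le_mul_of_one_le_left hl0 (one_le_pow₀ hd')
    nlinarith
  have h2 : (d : ℝ) * √lam ≤ 2 * √lam * (d * √(Real.log n)) := by
    have : 0 ≤ (d : ℝ) * √lam := by positivity
    nlinarith
  linarith

/-- The constant of the regret bound. -/
def regretConst (lam : ℝ) : ℝ :=
  4 + (2 + 2 * √lam + √(2 + volumeConst lam)) * (1 + 2 * volumeConst lam)

theorem QuantumBandit.IsLinUCB.regret_le_regretConst {lam : ℝ} (hlam : 0 < lam) {d n : ℕ}
    (hn : 2 ≤ n) {B : QuantumBandit d}
    (hB : ∀ O ∈ B.actionSet, ‖Matrix.toEuclideanCLM (n := Fin d) (𝕜 := ℂ) O‖ ≤ 1)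
    {σ : HermitianBasis d} {π : B.Policy}
    (hπ : B.IsLinUCB σ n lam d (√(d : ℝ)) (1 / (n : ℝ)) π) (ρ : QState d) :
    B.regret ρ π n ≤ regretConst lam * (d : ℝ) ^ 2 * √(n : ℝ) * Real.log n := by
  -- In dimension zero every trace vanishes, so there are no states.
  have hd : 0 < d := by
    rcases Nat.eq_zero_or_pos d with rfl | h
    · exact absurd ρ.2.2 (by simp)
    · exact h
  have hd' : (1 : ℝ) ≤ d := by exact_mod_cast hd
  have hn' : (2 : ℝ) ≤ n := by exact_mod_cast hn
  have hl := one_half_lt_log hn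
  have hl0 : 0 ≤ Real.log n := by linarith
  have hv := one_le_volumeConst hlam
  set ℓ := √(Real.log n) with hℓ
  have hℓ2 : ℓ ^ 2 = Real.log n := Real.sq_sqrt hl0
  have hℓ1 : 1 / 2 ≤ ℓ := Real.le_sqrt_of_sq_le (by linarith)
  set r := √(n : ℝ) with hr
  have hr2 : r ^ 2 = n := Real.sq_sqrt n.cast_nonneg
  have hr1 : 1 ≤ r := Real.one_le_sqrt.2 (by linarith)
  -- The summand 2 is not needed for the radius; it ensures $\kappa d\ell\ge 1$, as $d\ell\ge 1/2$.
  set κ := 2 + 2 * √lam + √(2 + volumeConst lam) with hκ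
  have hκ2 : 2 ≤ κ := by
    have := Real.sqrt_nonneg lam
    have := Real.sqrt_nonneg (2 + volumeConst lam)
    linarith
  have hdl : 1 / 2 ≤ d * ℓ := by nlinarith
  have hβ1 : 1 ≤ κ * (d * ℓ) := by nlinarith
  have hβ : LinUCB.radius (d ^ 2) n lam d (√(d : ℝ)) (1 / (n : ℝ)) ≤ κ * (d * ℓ) := by
    refine (radius_le hlam hd hn).trans (mul_le_mul_of_nonneg_right ?_ (by linarith))
    linarith
  -- With $c=\sqrt n/(d\sqrt{\log n})$ both $n\beta/c$ and $2\beta c\,d^2\log n$ are of order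
  -- $d^2\sqrt n\log n$.
  have hc : 0 < r / (d * ℓ) := by positivity
  refine (hπ.regret_le hB hd hlam (by positivity) ρ hc hβ1 hβ).trans ?_
  have h1 := mul_le_mul_of_nonneg_left (log_volume_le hlam hd hn)
    (show (0 : ℝ) ≤ ((d ^ 2 : ℕ) : ℝ) by positivity)
  have h2 := mul_le_mul_of_nonneg_left h1 (show 0 ≤ 2 * (κ * (d * ℓ)) * (r / (d * ℓ)) by positivity)
  have h3 : 2 * (κ * (d * ℓ)) * (r / (d * ℓ)) * (((d ^ 2 : ℕ) : ℝ) *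
      (volumeConst lam * Real.log n)) = κ * (2 * volumeConst lam) * (d ^ 2 * r * Real.log n) := by
    push_cast
    field_simp
  have h4 : (n : ℝ) * (2 * (1 / (n : ℝ)) + κ * (d * ℓ) / (r / (d * ℓ))) =
      2 + κ * (d ^ 2 * r * Real.log n) := by
    rw [← hℓ2, ← hr2]
    field_simp
  -- The 2 is the total cost $n\cdot 2\delta$ of the bad histories at $\delta=1/n$; absorbing it
  -- accounts for the 4 in `regretConst`.
  have h5 : 2 ≤ 4 * ((d : ℝ) ^ 2 * r * Real.log n) := by
    have h6 : (1 : ℝ) ≤ (d : ℝ) ^ 2 * r := one_le_mul_of_one_le_of_one_le (one_le_pow₀ hd') hr1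
    nlinarith
  rw [h4]
  have h7 : regretConst lam * (d : ℝ) ^ 2 * r * Real.log n =
      4 * ((d : ℝ) ^ 2 * r * Real.log n) + κ * (d ^ 2 * r * Real.log n) +
        κ * (2 * volumeConst lam) * (d ^ 2 * r * Real.log n) := by
    rw [regretConst]
    ring
  linarith

theorem regretConst_pos {lam : ℝ} (hlam : 0 < lam) : 0 < regretConst lam := by
  have := one_le_volumeConst hlam
  rw [regretConst]
  positivity

end

theorem mainTheorem4 (lam : ℝ) (hlam : 0 < lam) :
    ∃ C : ℝ, 0 < C ∧
      ∀ (d n : ℕ) (_hn : 2 ≤ n) (B : QuantumBandit d)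
        (_hB : ∀ O ∈ B.actionSet, ‖Matrix.toEuclideanCLM (n := Fin d) (𝕜 := ℂ) O‖ ≤ 1)
        (σ : HermitianBasis d),
        ((B.IsDiscrete ∨ B.IsCompactBorel) →
          ∃ π : B.Policy, B.IsLinUCB σ n lam d (√(d : ℝ)) (1 / (n : ℝ)) π) ∧
        ∀ π : B.Policy, B.IsLinUCB σ n lam d (√(d : ℝ)) (1 / (n : ℝ)) π →
          ∀ ρ : QState d, B.regret ρ π n ≤ C * (d : ℝ) ^ 2 * √(n : ℝ) * Real.log n := by
  refine ⟨regretConst lam, regretConst_pos hlam, fun d n hn B hB σ => ⟨fun h => ?_,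
    fun π hπ ρ => hπ.regret_le_regretConst hlam hn hB ρ⟩⟩
  exact (h.elim QuantumBandit.IsDiscrete.isCompactBorel id).exists_isLinUCB σ n hlam
    d.cast_nonneg _ _
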